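/- Let $F$ be the c.d.f. of a probability distribution on $[0,1]$ and let $n$ be a natural number. Consider the following two-player game $\Gamma_n^{NR}$ (competitive selection without recall). Independent samples $X_1,\dots,X_n$ with law $F$ arrive one after the other. At stage $t$ the players who are still in the game observe $X_t$ and simultaneously decide whether to bid for it or to pass, possibly at random. If exactly one player bids, he gets the item; if both bid, each of them gets it with probability $1/2$. A player who gets the item leaves with payoff $X_t$, the other one continues; an item that nobody takes is lost. A player who never gets an item has payoff $0$. After each stage the sample, who bid, and who got the item are publicly known. A strategy assigns measurably, to every history together with the current sample, a probability of bidding; players maximize expected payoffs. A strategy profile is a subgame perfect equilibrium (SPE) if it induces a Nash equilibrium in the continuation game after every finite history. Let $E_n^{NR}\subset\mathbb{R}^2$ be the set of expected payoff vectors of SPE of $\Gamma_n^{NR}$. Then $E_n^{NR}$ is symmetric with respect to the diagonal: $(u,v)\in E_n^{NR}$ implies $(v,u)\in E_n^{NR}$. If moreover $F$ is continuous, then $E_n^{NR}$ is convex and compact. -/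

import Mathlib

noncomputable section

open MeasureTheory

namespace NoRecallGame

/-- The finite set of possible "takers" of an item (`none`: nobody; `some i`: player `i`)
is a discrete measurable space. -/
instance instMeasurableSpaceTaker : MeasurableSpace (Option (Fin 2)) := ⊤

/-- Everything that happens at one stage: the sample, which of the two players tried to get it,
and who got it. -/
abbrev StageRecord : Type := unitInterval × (Fin 2 → Bool) × Option (Fin 2)

/-- The value of the sample that arrived at the stage. -/
def StageRecord.sample (r : StageRecord) : unitInterval := r.1

/-- `r.bids i = true` iff player `i` tried to get the sample. -/
def StageRecord.bids (r : StageRecord) : Fin 2 → Bool := r.2.1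

/-- The player who got the sample, if any. -/
def StageRecord.taker (r : StageRecord) : Option (Fin 2) := r.2.2

/-- Records of the first `t` stages. -/
abbrev History (t : ℕ) : Type := Fin t → StageRecord

/-- Player `i` has not obtained any item yet, hence is still in the game. -/
def Present {t : ℕ} (h : History t) (i : Fin 2) : Prop :=
  ∀ s, (h s).taker ≠ some i

/-- The histories that can occur under the rules: at every stage only players who are still in the
game bid, the item goes to one of the bidders, and nobody gets it only if nobody bids. -/
def Feasible {t : ℕ} (h : History t) : Prop :=
  ∀ s : Fin t,
    (∀ i, (h s).bids i = true → ∀ r : Fin t, r < s → (h r).taker ≠ some i) ∧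
    (∀ i, (h s).taker = some i → (h s).bids i = true) ∧
    ((h s).taker = none → ∀ i, (h s).bids i = false)

/-- The history `h` followed by one more stage. -/
def addStage {t : ℕ} (h : History t) (r : StageRecord) : History (t + 1) :=
  Fin.snoc (α := fun _ => StageRecord) h r

/-- A (behaviour) strategy: `bid t h x` is the probability of selecting the current sample `x`
(rather than passing) after a history `h` of `t` stages. In the game with `n` samples only the
components `t < n` on feasible histories at which the player is still present matter. -/
structure Strategy where
  bid : (t : ℕ) → History t → unitInterval → unitInterval
  measurable_bid : ∀ t, Measurable fun p : History t × unitInterval => bid t p.1 p.2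

/-- A strategy for each of the two players. -/
abbrev Profile : Type := Fin 2 → Strategy

open Classical in
/-- The probability that player `i` bids (`b = true`) or does not bid (`b = false`) for the current
sample `x` after history `h`. A player who has already left the market does not bid. -/
def bidProb (σ : Profile) {t : ℕ} (h : History t) (x : unitInterval) (i : Fin 2) (b : Bool) : ℝ :=
  let q : ℝ := if Present h i then ((σ i).bid t h x : ℝ) else 0
  if b = true then q else 1 - q

/-- The allocation rule: an item is given to one of its bidders, chosen uniformly at random;
`allocProb b w` is the probability that the taker is `w` when the bids are `b`. -/
def allocProb (b : Fin 2 → Bool) : Option (Fin 2) → ℝ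
  | none => if ∀ i, b i = false then 1 else 0
  | some i => if b i = true then 1 / (∑ j, if b j = true then 1 else 0) else 0

/-- The expectation of `g` (record of the current stage) when the history is `h`, the current
sample is `x` and the players, randomizing independently, follow `σ`. -/
def stageExpectation (σ : Profile) {t : ℕ} (h : History t) (x : unitInterval)
    (g : StageRecord → ℝ) : ℝ :=
  ∑ b : Fin 2 → Bool, ∑ w : Option (Fin 2),
    (∏ i, bidProb σ h x i (b i)) * allocProb b w * g (x, b, w)

/-- The value obtained by player `i` along `h`: the value of the item that he got, and `0` if he got
none (along a feasible history at most one summand is nonzero). -/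
def receipts {t : ℕ} (h : History t) (i : Fin 2) : ℝ :=
  ∑ s, if (h s).taker = some i then ((h s).sample : ℝ) else 0

/-- The expected payoff of player `i` in the continuation game after the history `h`, when `m`
samples, i.i.d. with law `μ`, are still to arrive and `σ` is played. -/
def contPayoff (μ : Measure unitInterval) (σ : Profile) (i : Fin 2) :
    (m : ℕ) → {t : ℕ} → History t → ℝ
  | 0, _, h => receipts h i
  | m + 1, _, h => ∫ x, stageExpectation σ h x fun r => contPayoff μ σ i m (addStage h r) ∂μ

/-- The same after the history `h` and the observation of the current sample `x`, about which the
players have not yet decided; `m` more samples are to arrive after `x`. -/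
def contPayoffAt (μ : Measure unitInterval) (σ : Profile) (i : Fin 2) (m : ℕ) {t : ℕ}
    (h : History t) (x : unitInterval) : ℝ :=
  stageExpectation σ h x fun r => contPayoff μ σ i m (addStage h r)

/-- `σ` is a subgame perfect equilibrium of the game with `n` samples of law `μ`: in the
continuation game after every history, be it taken just before or just after the observation of a
sample, no player can gain by a unilateral change of strategy. -/
def IsSPE (μ : Measure unitInterval) (n : ℕ) (σ : Profile) : Prop :=
  (∀ (t m : ℕ), t + m = n → ∀ h : History t, Feasible h → ∀ (i : Fin 2) (τ : Strategy),
      contPayoff μ (Function.update σ i τ) i m h ≤ contPayoff μ σ i m h) ∧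
  (∀ (t m : ℕ), t + 1 + m = n → ∀ h : History t, Feasible h → ∀ (x : unitInterval)
      (i : Fin 2) (τ : Strategy),
      contPayoffAt μ (Function.update σ i τ) i m h x ≤ contPayoffAt μ σ i m h x)

/-- The expected payoff of player `i` in the game with `n` samples of law `μ`. -/
def payoff (μ : Measure unitInterval) (n : ℕ) (σ : Profile) (i : Fin 2) : ℝ :=
  contPayoff μ σ i n (Fin.elim0 : History 0)

/-- The set of subgame perfect equilibrium payoffs of the no-recall game with `n` samples. -/
def spePayoffs (μ : Measure unitInterval) (n : ℕ) : Set (ℝ × ℝ) :=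
  {p | ∃ σ : Profile, IsSPE μ n σ ∧ p = (payoff μ n σ 0, payoff μ n σ 1)}

/-- The cumulative distribution function of a law `μ` on `[0, 1]`. -/
def distributionFunction (μ : Measure unitInterval) : ℝ → ℝ :=
  fun y => ProbabilityTheory.cdf (μ.map ((↑) : unitInterval → ℝ)) y

end NoRecallGame

end

noncomputable section

open MeasureTheory

namespace NoRecallGame

/-! ### Measurable selection of zeros and maximizers of Carathéodory functions -/

section Selection

variable {Y Z : Type*} [MeasurableSpace Y]

/-! Symmetry needs no continuity: exchanging the roles in histories and strategies carries
deviations to deviations and payoffs to payoffs (`contPayoff_swapProfile`, `IsSPE.swap`).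

For the rest, once one player has taken an item, the other one faces an optimal stopping problem and
earns `soloValue` in every equilibrium. Hence, while both are present, a stage with sample `x` is a
2×2 game determined by `x`, by `soloValue μ m` and by the payoffs `v` that follow if both pass. So
the equilibrium payoffs with `m + 1` samples to arrive should be the integrals over `x` of
measurable selections from the stage equilibrium payoffs with `v` in the set for `m` samples. This
is the recursion `eqValues`, and `spePayoffs_eq_eqValues` identifies it with the set in question.
One inclusion is `IsSPE.mem_eqValues`. For the other, a promised payoff vector serves as state
variable: it is delivered by continuation promises and bids that depend measurably on the promise
and the sample (`exists_implementation`), and the one-shot deviation principle shows that the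
resulting strategies are an equilibrium (`isSPE_promiseStrategy`).

Convexity and compactness of `eqValues` follow by induction from a planar version of the theorems of
Lyapunov and Aumann, `integralSet_spec`: for an atomless law the integral of a correspondence with
closed graph in the unit square is the compact convex set cut out by its support function. Extreme
selections of a face are spliced to reach every boundary point, and selections with integrals above
and below a given point are spliced to reach that point. Splicing is an intermediate value argument
on a connected level set (`exists_vint_splice_eq`). All choices are made measurably in the target
point, because the strategies require it. -/

theorem measurableSet_exists_zero [MetricSpace Z] {C : Set Z} (hC : IsCompact C) {Φ : Y → Z → ℝ}
    (hm : ∀ z, Measurable fun y => Φ y z) (hc : ∀ y, Continuous (Φ y))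
    (h0 : ∀ y z, 0 ≤ Φ y z) : MeasurableSet {y | ∃ z ∈ C, Φ y z = 0} := by
  obtain ⟨D, hDC, hDc, hCD⟩ := hC.isSeparable.exists_countable_dense_subset
  -- A nonnegative continuous function has a zero on a compact set iff its infimum over a countable
  -- dense subset is 0, which is a countable condition.
  have key : {y | ∃ z ∈ C, Φ y z = 0} =
      ⋂ k : ℕ, ⋃ z ∈ D, {y | Φ y z < 1 / ((k : ℝ) + 1)} := by
    ext y
    simp only [Set.mem_ofPred_eq, Set.mem_iInter, Set.mem_iUnion, exists_prop]
    constructor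
    · rintro ⟨z, hz, hz0⟩ k
      have hpos : (0 : ℝ) < 1 / ((k : ℝ) + 1) := by positivity
      have hopen : IsOpen {z | Φ y z < 1 / ((k : ℝ) + 1)} :=
        isOpen_lt (hc y) continuous_const
      obtain ⟨d, hd, hdD⟩ := mem_closure_iff.1 (hCD hz) _ hopen (by simpa [hz0] using hpos)
      exact ⟨d, hdD, hd⟩
    · intro h
      have hne : C.Nonempty := by
        obtain ⟨z, hz, -⟩ := h 0
        exact ⟨z, hDC hz⟩
      obtain ⟨z, hz, hmin⟩ := hC.exists_isMinOn hne (hc y).continuousOn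
      refine ⟨z, hz, le_antisymm ?_ (h0 y z)⟩
      refine le_of_forall_pos_lt_add fun ε hε => ?_
      obtain ⟨k, hk⟩ := exists_nat_one_div_lt hε
      obtain ⟨d, hd, hdk⟩ := h k
      have := hmin (hDC hd)
      simp only [Set.mem_ofPred_eq] at this
      linarith
  rw [key]
  exact MeasurableSet.iInter fun k => MeasurableSet.biUnion hDc fun z _ =>
    measurableSet_lt (hm z) measurable_const

/-- The least zero is measurable: it is at most `r` iff there is a zero in the compact set of points
`≤ r`. -/
theorem exists_measurable_zero_real {T : Set ℝ} [CompactSpace T] {Φ : Y → T → ℝ}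
    (hm : ∀ z, Measurable fun y => Φ y z) (hc : ∀ y, Continuous (Φ y))
    (h0 : ∀ y z, 0 ≤ Φ y z) (hex : ∀ y, ∃ z, Φ y z = 0) :
    ∃ s : Y → T, Measurable s ∧ ∀ y, Φ y (s y) = 0 := by
  have hleast : ∀ y, ∃ z, Φ y z = 0 ∧ ∀ z', Φ y z' = 0 → z ≤ z' := by
    intro y
    have hcl : IsCompact {z | Φ y z = 0} := (isClosed_eq (hc y) continuous_const).isCompact
    obtain ⟨z, hz, hmin⟩ := hcl.exists_isMinOn (hex y) continuous_subtype_val.continuousOn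
    exact ⟨z, hz, fun z' hz' => hmin hz'⟩
  choose s hs hle using hleast
  refine ⟨s, ?_, hs⟩
  refine Measurable.subtype_mk (f := fun y => (s y : ℝ)) (measurable_of_Iic fun r => ?_)
  have hcl : IsCompact {z : T | (z : ℝ) ≤ r} :=
    (isClosed_le continuous_subtype_val continuous_const).isCompact
  convert measurableSet_exists_zero hcl hm hc h0 using 1
  ext y
  simp only [Set.mem_preimage, Set.mem_Iic, Set.mem_ofPred_eq]
  exact ⟨fun h => ⟨s y, h, hs y⟩, fun ⟨z, hz, hz0⟩ => le_trans (Subtype.coe_le_coe.2 (hle y z hz0)) hz⟩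

/-- A compact metric space is a continuous image of the Cantor set, a compact set of reals, so zeros
can be pulled back to the real case. -/
theorem exists_measurable_zero [MetricSpace Z] [MeasurableSpace Z] [BorelSpace Z] {C : Set Z}
    (hC : IsCompact C) {Φ : Y → Z → ℝ}
    (hm : ∀ z, Measurable fun y => Φ y z) (hc : ∀ y, Continuous (Φ y))
    (h0 : ∀ y z, 0 ≤ Φ y z) (hex : ∀ y, ∃ z ∈ C, Φ y z = 0) :
    ∃ s : Y → Z, Measurable s ∧ ∀ y, s y ∈ C ∧ Φ y (s y) = 0 := by
  rcases isEmpty_or_nonempty Y with hY | ⟨⟨y₀⟩⟩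
  · exact ⟨fun y => isEmptyElim y, measurable_of_empty _, fun y => isEmptyElim y⟩
  have hCne : Nonempty C := by
    obtain ⟨z, hz, -⟩ := hex y₀
    exact ⟨⟨z, hz⟩⟩
  have : CompactSpace C := isCompact_iff_compactSpace.1 hC
  have : CompactSpace cantorSet := isCompact_iff_compactSpace.1 isCompact_cantorSet
  obtain ⟨f, hf, hfs⟩ := exists_nat_bool_continuous_surjective_of_compact C
  set g : cantorSet → Z := fun c => f (cantorSetHomeomorphNatToBool c) with hg
  have hgc : Continuous g := by fun_prop
  obtain ⟨s, hs, hs0⟩ := exists_measurable_zero_real (Φ := fun y c => Φ y (g c))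
    (fun c => hm _) (fun y => (hc y).comp hgc) (fun _ _ => h0 _ _) (by
      intro y
      obtain ⟨z, hz, hz0⟩ := hex y
      obtain ⟨b, hb⟩ := hfs ⟨z, hz⟩
      exact ⟨cantorSetHomeomorphNatToBool.symm b, by simp [hg, hb, hz0]⟩)
  exact ⟨fun y => g (s y), hgc.measurable.comp hs, fun y => ⟨Subtype.coe_prop _, hs0 y⟩⟩

/-- A measurable selection of maximizers of `ψ` on the zero set of `Φ`. -/
theorem exists_measurable_argmax [MetricSpace Z] [MeasurableSpace Z] [BorelSpace Z] {C : Set Z}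
    (hC : IsCompact C) {Φ ψ : Y → Z → ℝ}
    (hm : ∀ z, Measurable fun y => Φ y z) (hc : ∀ y, Continuous (Φ y))
    (h0 : ∀ y z, 0 ≤ Φ y z) (hex : ∀ y, ∃ z ∈ C, Φ y z = 0)
    (hψm : ∀ z, Measurable fun y => ψ y z) (hψc : ∀ y, Continuous (ψ y)) :
    ∃ s : Y → Z, Measurable s ∧ (∀ y, s y ∈ C ∧ Φ y (s y) = 0) ∧
      Measurable (fun y => ψ y (s y)) ∧ ∀ y, ∀ z ∈ C, Φ y z = 0 → ψ y z ≤ ψ y (s y) := by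
  have hmax : ∀ y, ∃ z ∈ C, Φ y z = 0 ∧ ∀ z' ∈ C, Φ y z' = 0 → ψ y z' ≤ ψ y z := by
    intro y
    have hcl : IsCompact (C ∩ {z | Φ y z = 0}) :=
      hC.inter_right (isClosed_eq (hc y) continuous_const)
    obtain ⟨z, hz, hmax⟩ := hcl.exists_isMaxOn (hex y) (hψc y).continuousOn
    exact ⟨z, hz.1, hz.2, fun z' hz' h => hmax ⟨hz', h⟩⟩
  choose t htC ht0 htmax using hmax
  -- The maximum is at least `a` iff `Φ` plus the positive part of `a - ψ` has a zero. Once the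
  -- maximum is measurable, the maximizers are themselves the zeros of a function of the required
  -- kind.
  have hM : Measurable fun y => ψ y (t y) := by
    refine measurable_of_Ici fun a => ?_
    convert measurableSet_exists_zero hC (Φ := fun y z => Φ y z + max (a - ψ y z) 0)
      (fun z => (hm z).add ((measurable_const.sub (hψm z)).max measurable_const))
      (fun y => (hc y).add ((continuous_const.sub (hψc y)).max continuous_const))
      (fun y z => add_nonneg (h0 y z) (le_max_right _ _)) using 1
    ext y
    simp only [Set.mem_preimage, Set.mem_Ici, Set.mem_ofPred_eq]
    constructor
    · intro h
      exact ⟨t y, htC y, by rw [ht0, max_eq_right (by linarith), add_zero]⟩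
    · rintro ⟨z, hz, hz0⟩
      have h1 := h0 y z
      have h2 := le_max_right (a - ψ y z) 0
      have h3 := le_max_left (a - ψ y z) 0
      have := htmax y z hz (by linarith)
      linarith
  obtain ⟨s, hs, hsz⟩ := exists_measurable_zero hC
    (Φ := fun y z => Φ y z + |ψ y z - ψ y (t y)|)
    (fun z => (hm z).add ((hψm z).sub hM).abs)
    (fun y => (hc y).add ((hψc y).sub continuous_const).abs)
    (fun y z => add_nonneg (h0 y z) (abs_nonneg _))
    (fun y => ⟨t y, htC y, by simp [ht0]⟩)
  have hsz' : ∀ y, Φ y (s y) = 0 ∧ ψ y (s y) = ψ y (t y) := by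
    intro y
    have h1 := h0 y (s y)
    have h2 := abs_nonneg (ψ y (s y) - ψ y (t y))
    have h3 := (hsz y).2
    refine ⟨by linarith, ?_⟩
    have : |ψ y (s y) - ψ y (t y)| = 0 := by linarith
    linarith [abs_eq_zero.1 this]
  refine ⟨s, hs, fun y => ⟨(hsz y).1, (hsz' y).1⟩, ?_, fun y z hz hz0 => ?_⟩
  · simpa only [(hsz' _).2] using hM
  · rw [(hsz' y).2]
    exact htmax y z hz hz0

end Selection

/-! ### Plane vectors, and splicing two selections -/

section Splice

/-- The scalar product of a plane vector with the unit vector of angle `θ`. -/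
def proj (θ : ℝ) (z : ℝ × ℝ) : ℝ := Real.cos θ * z.1 + Real.sin θ * z.2

theorem continuous_proj_right (θ : ℝ) : Continuous (proj θ) := by
  unfold proj; fun_prop

theorem continuous_proj : Continuous fun p : ℝ × (ℝ × ℝ) => proj p.1 p.2 := by
  unfold proj; fun_prop

theorem measurable_proj {Y : Type*} [MeasurableSpace Y] {θ : Y → ℝ} {f : Y → ℝ × ℝ}
    (hθ : Measurable θ) (hf : Measurable f) : Measurable fun y => proj (θ y) (f y) := by
  unfold proj; fun_prop

theorem proj_add_pi_div_two (θ : ℝ) (z : ℝ × ℝ) :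
    proj (θ + Real.pi / 2) z = - Real.sin θ * z.1 + Real.cos θ * z.2 := by
  simp [proj, Real.cos_add_pi_div_two, Real.sin_add_pi_div_two]

theorem proj_add (θ ε : ℝ) (z : ℝ × ℝ) :
    proj (θ + ε) z = Real.cos ε * proj θ z + Real.sin ε * proj (θ + Real.pi / 2) z := by
  rw [proj_add_pi_div_two]
  simp only [proj, Real.cos_add, Real.sin_add]
  ring

theorem eq_of_proj_eq {θ : ℝ} {z w : ℝ × ℝ} (h : proj θ z = proj θ w)
    (h' : proj (θ + Real.pi / 2) z = proj (θ + Real.pi / 2) w) : z = w := by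
  rw [proj_add_pi_div_two, proj_add_pi_div_two] at h'
  unfold proj at h
  have hs := Real.sin_sq_add_cos_sq θ
  ext
  · linear_combination Real.cos θ * h - Real.sin θ * h' - (z.1 - w.1) * hs
  · linear_combination Real.sin θ * h + Real.cos θ * h' - (z.2 - w.2) * hs

theorem abs_proj_le {θ : ℝ} {z : ℝ × ℝ} (hz : z ∈ Set.Icc (0 : ℝ × ℝ) 1) : |proj θ z| ≤ 2 := by
  obtain ⟨⟨h1, h2⟩, h3, h4⟩ := hz
  simp only [Prod.fst_zero, Prod.snd_zero, Prod.fst_one, Prod.snd_one] at h1 h2 h3 h4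
  have hc := abs_le.1 (Real.abs_cos_le_one θ)
  have hs := abs_le.1 (Real.abs_sin_le_one θ)
  unfold proj
  rw [abs_le]
  constructor <;> nlinarith

/-- The coordinatewise integral of a function with values in the plane. -/
def vint (μ : Measure unitInterval) (w : unitInterval → ℝ × ℝ) : ℝ × ℝ :=
  (∫ x, (w x).1 ∂μ, ∫ x, (w x).2 ∂μ)

variable {μ : Measure unitInterval} [IsProbabilityMeasure μ]

theorem integrable_of_abs_le {f : unitInterval → ℝ} (hf : Measurable f) (B : ℝ)
    (hB : ∀ x, |f x| ≤ B) : Integrable f μ :=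
  Integrable.of_bound hf.aestronglyMeasurable B (Filter.Eventually.of_forall hB)

theorem integrable_fst_of_mem_box {w : unitInterval → ℝ × ℝ} (hw : Measurable w)
    (hb : ∀ x, w x ∈ Set.Icc (0 : ℝ × ℝ) 1) : Integrable (fun x => (w x).1) μ :=
  integrable_of_abs_le hw.fst 1 fun x => abs_le.2 ⟨by linarith [
    show (0 : ℝ) ≤ (w x).1 from (hb x).1.1], (hb x).2.1⟩

theorem integrable_snd_of_mem_box {w : unitInterval → ℝ × ℝ} (hw : Measurable w)
    (hb : ∀ x, w x ∈ Set.Icc (0 : ℝ × ℝ) 1) : Integrable (fun x => (w x).2) μ :=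
  integrable_of_abs_le hw.snd 1 fun x => abs_le.2 ⟨by linarith [
    show (0 : ℝ) ≤ (w x).2 from (hb x).1.2], (hb x).2.2⟩

theorem integrable_proj {w : unitInterval → ℝ × ℝ} (hw : Measurable w)
    (hb : ∀ x, w x ∈ Set.Icc (0 : ℝ × ℝ) 1) (θ : ℝ) : Integrable (fun x => proj θ (w x)) μ :=
  ((integrable_fst_of_mem_box hw hb).const_mul _).add ((integrable_snd_of_mem_box hw hb).const_mul _)

theorem proj_vint {w : unitInterval → ℝ × ℝ} (hw : Measurable w)
    (hb : ∀ x, w x ∈ Set.Icc (0 : ℝ × ℝ) 1) (θ : ℝ) :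
    proj θ (vint μ w) = ∫ x, proj θ (w x) ∂μ := by
  unfold proj vint
  rw [integral_add ((integrable_fst_of_mem_box hw hb).const_mul _)
    ((integrable_snd_of_mem_box hw hb).const_mul _), integral_const_mul, integral_const_mul]

theorem vint_mem_box {w : unitInterval → ℝ × ℝ} (hw : Measurable w)
    (hb : ∀ x, w x ∈ Set.Icc (0 : ℝ × ℝ) 1) : vint μ w ∈ Set.Icc (0 : ℝ × ℝ) 1 := by
  have h1 := integrable_fst_of_mem_box (μ := μ) hw hb
  have h2 := integrable_snd_of_mem_box (μ := μ) hw hb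
  refine ⟨⟨integral_nonneg fun x => (hb x).1.1, integral_nonneg fun x => (hb x).1.2⟩, ?_, ?_⟩
  · simpa [vint] using integral_mono h1 (integrable_const 1) fun x => (hb x).2.1
  · simpa [vint] using integral_mono h2 (integrable_const 1) fun x => (hb x).2.2

/-- The projection to the first coordinate is a closed surjection, hence a quotient map, onto an
interval. Its fibres are level sets of a monotone continuous function, hence nonempty intervals. A
quotient map with connected fibres and connected image has connected source. -/
theorem isPreconnected_level {P N : unitInterval → ℝ} (hP : Continuous P) (hN : Continuous N)
    (hmono : Monotone N) (hr : ∀ r, P r ∈ Set.Icc (N 0) (N 1)) :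
    IsPreconnected {z : unitInterval × unitInterval | P z.1 = N z.2} := by
  set S := {z : unitInterval × unitInterval | P z.1 = N z.2} with hS
  have hScl : IsClosed S := isClosed_eq (hP.comp continuous_fst) (hN.comp continuous_snd)
  have : CompactSpace S := isCompact_iff_compactSpace.1 hScl.isCompact
  have hfc : Continuous fun z : S => (z : unitInterval × unitInterval).1 := by fun_prop
  have hfib : ∀ r, IsConnected ((fun z : S => (z : unitInterval × unitInterval).1) ⁻¹' {r}) := by
    intro r
    have hsec : IsConnected {ρ | N ρ = P r} := by
      constructor
      · obtain ⟨ρ, -, hρ⟩ := intermediate_value_Icc (zero_le_one (α := unitInterval))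
          hN.continuousOn (hr r)
        exact ⟨ρ, hρ⟩
      · refine Set.OrdConnected.isPreconnected ⟨fun a ha b hb c hc => ?_⟩
        have h1 := hmono hc.1
        have h2 := hmono hc.2
        simp only [Set.mem_ofPred_eq] at ha hb ⊢
        linarith
    have himg : ((fun z : S => (z : unitInterval × unitInterval).1) ⁻¹' {r}) =
        Set.range fun ρ : {ρ | N ρ = P r} => (⟨(r, ρ), ρ.2.symm⟩ : S) := by
      ext ⟨⟨a, b⟩, hab⟩
      simp only [Set.mem_preimage, Set.mem_singleton_iff, Set.mem_range, Subtype.mk.injEq,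
        Prod.mk.injEq]
      constructor
      · rintro rfl
        exact ⟨⟨b, hab.symm⟩, rfl, rfl⟩
      · rintro ⟨-, h, -⟩
        exact h.symm
    rw [himg]
    have : ConnectedSpace {ρ | N ρ = P r} := isConnected_iff_connectedSpace.1 hsec
    exact isConnected_range (by fun_prop)
  have hsurj : Function.Surjective fun z : S => (z : unitInterval × unitInterval).1 := by
    intro r
    obtain ⟨z, hz⟩ := (hfib r).nonempty
    exact ⟨z, hz⟩
  have hq := (hfc.isClosedMap.isQuotientMap hfc hsurj)
  have huniv := hq.isCoinducing.isConnected_preimage_of_isClosed hfib isClosed_univ isConnected_univ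
  have := huniv.isPreconnected.image (Subtype.val) continuous_subtype_val.continuousOn
  simpa using this

-- Moving a threshold affects the integrand only at points near it, and the threshold itself is a
-- null set, so dominated convergence applies.
open Classical in
theorem continuous_integral_threshold [NullSingletonClass μ] {D : Set unitInterval} {a b : unitInterval → ℝ}
    (hD : MeasurableSet D) (ha : Measurable a) (hb : Measurable b) (B : ℝ) (haB : ∀ x, |a x| ≤ B)
    (hbB : ∀ x, |b x| ≤ B) :
    Continuous fun z : unitInterval × unitInterval =>
      ∫ x, (if (x ∈ D ∧ x ≤ z.1) ∨ (x ∉ D ∧ x ≤ z.2) then a x else b x) ∂μ := by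
  rw [continuous_iff_continuousAt]
  intro z
  refine continuousAt_of_dominated (bound := fun _ => B) ?_ ?_ (integrable_const _) ?_
  · refine Filter.Eventually.of_forall fun z => Measurable.aestronglyMeasurable ?_
    exact Measurable.ite ((hD.inter measurableSet_Iic).union (hD.compl.inter measurableSet_Iic))
      ha hb
  · refine Filter.Eventually.of_forall fun z => Filter.Eventually.of_forall fun x => ?_
    split_ifs
    exacts [haB x, hbB x]
  · have h1 : ∀ᵐ x ∂μ, x ≠ z.1 := by simp [ae_iff]
    have h2 : ∀ᵐ x ∂μ, x ≠ z.2 := by simp [ae_iff]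
    filter_upwards [h1, h2] with x hx1 hx2
    have e1 : ∀ᶠ z' : unitInterval × unitInterval in nhds z, (x ≤ z'.1 ↔ x ≤ z.1) := by
      rcases lt_or_gt_of_ne hx1 with h | h
      · filter_upwards [continuous_fst.continuousAt.eventually (lt_mem_nhds h)] with z' hz'
        exact iff_of_true hz'.le h.le
      · filter_upwards [continuous_fst.continuousAt.eventually (gt_mem_nhds h)] with z' hz'
        exact iff_of_false hz'.not_ge h.not_ge
    have e2 : ∀ᶠ z' : unitInterval × unitInterval in nhds z, (x ≤ z'.2 ↔ x ≤ z.2) := by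
      rcases lt_or_gt_of_ne hx2 with h | h
      · filter_upwards [continuous_snd.continuousAt.eventually (lt_mem_nhds h)] with z' hz'
        exact iff_of_true hz'.le h.le
      · filter_upwards [continuous_snd.continuousAt.eventually (gt_mem_nhds h)] with z' hz'
        exact iff_of_false hz'.not_ge h.not_ge
    refine (continuousAt_const (y := if (x ∈ D ∧ x ≤ z.1) ∨ (x ∉ D ∧ x ≤ z.2) then a x
      else b x)).congr ?_
    filter_upwards [e1, e2] with z' h1 h2
    simp only [h1, h2]

open Classical in
theorem integrable_primitive {D : Set unitInterval} {k : unitInterval → ℝ} (hD : MeasurableSet D)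
    (hk : Measurable k) (B : ℝ) (hkB : ∀ x, |k x| ≤ B) (r : unitInterval) :
    Integrable (fun x => if x ∈ D ∧ x ≤ r then k x else 0) μ :=
  integrable_of_abs_le (Measurable.ite (hD.inter measurableSet_Iic) hk measurable_const) B
    fun x => by
      split_ifs
      exacts [hkB x, by simpa using (abs_nonneg _).trans (hkB x)]

open Classical in
theorem continuous_primitive [NullSingletonClass μ] {D : Set unitInterval} {k : unitInterval → ℝ}
    (hD : MeasurableSet D) (hk : Measurable k) (B : ℝ) (hkB : ∀ x, |k x| ≤ B) :
    Continuous fun r => ∫ x, (if x ∈ D ∧ x ≤ r then k x else 0) ∂μ := by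
  have h0 : 0 ≤ B := (abs_nonneg _).trans (hkB 0)
  -- The indicator of `D` is put into the integrand, and both thresholds are set equal to `r`.
  have := continuous_integral_threshold (μ := μ) (D := Set.univ) (a := D.indicator k)
    (b := fun _ => 0) MeasurableSet.univ (hk.indicator hD) measurable_const B
    (fun x => (by
      by_cases hx : x ∈ D
      · simpa [hx] using hkB x
      · simpa [hx] using h0)) (by simpa using h0)
  refine (this.comp (continuous_id.prodMk continuous_id)).congr fun r => ?_
  refine integral_congr_ae (Filter.Eventually.of_forall fun x => ?_)
  by_cases hx : x ∈ D <;> by_cases hr : x ≤ r <;> simp [hx, hr]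

open Classical in
theorem monotone_primitive {D : Set unitInterval} {k : unitInterval → ℝ}
    (hD : MeasurableSet D) (hk : Measurable k) (B : ℝ) (hkB : ∀ x, |k x| ≤ B)
    (h0 : ∀ x ∈ D, 0 ≤ k x) :
    Monotone fun r => ∫ x, (if x ∈ D ∧ x ≤ r then k x else 0) ∂μ := by
  intro r r' h
  refine integral_mono (integrable_primitive hD hk B hkB r) (integrable_primitive hD hk B hkB r')
    fun x => ?_
  by_cases hr : x ∈ D ∧ x ≤ r
  · simp only [hr, hr.2.trans h, and_self, if_true, le_refl]
  · simp only [hr, if_false]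
    split_ifs with h'
    exacts [h0 x h'.1, le_rfl]

/-- The points at which `f` is at least as large as `g` in the direction `θ`. -/
def favorable (θ : ℝ) (f g : unitInterval → ℝ × ℝ) : Set unitInterval :=
  {x | proj θ (g x) ≤ proj θ (f x)}

open Classical in
/-- `f` below a threshold and `g` above it, where the threshold depends on which of `f`, `g` is
larger in the direction `θ`. -/
def splice (θ : ℝ) (f g : unitInterval → ℝ × ℝ) (z : unitInterval × unitInterval)
    (x : unitInterval) : ℝ × ℝ :=
  if (x ∈ favorable θ f g ∧ x ≤ z.1) ∨ (x ∉ favorable θ f g ∧ x ≤ z.2) then f x else g x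

theorem measurable_splice {Y : Type*} [MeasurableSpace Y] {θ : Y → ℝ}
    {f g : Y → unitInterval → ℝ × ℝ} {z : Y → unitInterval × unitInterval}
    (hθ : Measurable θ) (hf : Measurable fun p : Y × unitInterval => f p.1 p.2)
    (hg : Measurable fun p : Y × unitInterval => g p.1 p.2) (hz : Measurable z) :
    Measurable fun p : Y × unitInterval => splice (θ p.1) (f p.1) (g p.1) (z p.1) p.2 := by
  have hD : MeasurableSet {p : Y × unitInterval |
      proj (θ p.1) (g p.1 p.2) ≤ proj (θ p.1) (f p.1 p.2)} :=
    measurableSet_le (measurable_proj (hθ.comp measurable_fst) hg)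
      (measurable_proj (hθ.comp measurable_fst) hf)
  have h1 : MeasurableSet {p : Y × unitInterval | p.2 ≤ (z p.1).1} :=
    measurableSet_le measurable_snd (hz.fst.comp measurable_fst)
  have h2 : MeasurableSet {p : Y × unitInterval | p.2 ≤ (z p.1).2} :=
    measurableSet_le measurable_snd (hz.snd.comp measurable_fst)
  unfold splice
  refine Measurable.ite ?_ hf hg
  exact (hD.inter h1).union (hD.compl.inter h2)

theorem measurable_splice_apply {θ : ℝ} {f g : unitInterval → ℝ × ℝ} (hf : Measurable f)
    (hg : Measurable g) (z : unitInterval × unitInterval) : Measurable (splice θ f g z) :=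
  (measurable_splice (Y := Unit) (θ := fun _ => θ) (f := fun _ => f) (g := fun _ => g)
    (z := fun _ => z) measurable_const (hf.comp measurable_snd) (hg.comp measurable_snd)
    measurable_const).comp (measurable_const (a := ()) |>.prodMk measurable_id)

theorem splice_eq_or (θ : ℝ) (f g : unitInterval → ℝ × ℝ) (z : unitInterval × unitInterval)
    (x : unitInterval) : splice θ f g z x = f x ∨ splice θ f g z x = g x := by
  unfold splice
  split_ifs
  exacts [Or.inl rfl, Or.inr rfl]

theorem splice_mem_box {θ : ℝ} {f g : unitInterval → ℝ × ℝ} {z : unitInterval × unitInterval}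
    (hf : ∀ x, f x ∈ Set.Icc (0 : ℝ × ℝ) 1) (hg : ∀ x, g x ∈ Set.Icc (0 : ℝ × ℝ) 1)
    (x : unitInterval) : splice θ f g z x ∈ Set.Icc (0 : ℝ × ℝ) 1 := by
  rcases splice_eq_or θ f g z x with h | h <;> rw [h]
  exacts [hf x, hg x]

theorem measurableSet_favorable {θ : ℝ} {f g : unitInterval → ℝ × ℝ} (hf : Measurable f)
    (hg : Measurable g) : MeasurableSet (favorable θ f g) :=
  measurableSet_le (measurable_proj measurable_const hg) (measurable_proj measurable_const hf)

theorem continuous_vint_splice [NullSingletonClass μ] {θ : ℝ} {f g : unitInterval → ℝ × ℝ}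
    (hf : Measurable f) (hg : Measurable g) (hfb : ∀ x, f x ∈ Set.Icc (0 : ℝ × ℝ) 1)
    (hgb : ∀ x, g x ∈ Set.Icc (0 : ℝ × ℝ) 1) : Continuous fun z => vint μ (splice θ f g z) := by
  have hD := measurableSet_favorable (θ := θ) hf hg
  refine Continuous.prodMk ?_ ?_
  · simp only [splice, apply_ite Prod.fst]
    exact continuous_integral_threshold (μ := μ) hD hf.fst hg.fst 1
      (fun x => abs_le.2 ⟨by linarith [show (0 : ℝ) ≤ (f x).1 from (hfb x).1.1], (hfb x).2.1⟩)
      (fun x => abs_le.2 ⟨by linarith [show (0 : ℝ) ≤ (g x).1 from (hgb x).1.1], (hgb x).2.1⟩)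
  · simp only [splice, apply_ite Prod.snd]
    exact continuous_integral_threshold (μ := μ) hD hf.snd hg.snd 1
      (fun x => abs_le.2 ⟨by linarith [show (0 : ℝ) ≤ (f x).2 from (hfb x).1.2], (hfb x).2.2⟩)
      (fun x => abs_le.2 ⟨by linarith [show (0 : ℝ) ≤ (g x).2 from (hgb x).1.2], (hgb x).2.2⟩)

-- Thresholds 0 change the function at the point 0 only, which has measure 0.
omit [IsProbabilityMeasure μ] in
theorem vint_splice_zero [NullSingletonClass μ] (θ : ℝ) (f g : unitInterval → ℝ × ℝ) :
    vint μ (splice θ f g ((0, 0) : unitInterval × unitInterval)) = vint μ g := by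
  have h : ∀ᵐ x ∂μ, splice θ f g ((0, 0) : unitInterval × unitInterval) x = g x := by
    have h0 : ∀ᵐ x ∂μ, x ≠ 0 := by simp [ae_iff]
    filter_upwards [h0] with x hx
    have : ¬ x ≤ 0 := fun h => hx (le_antisymm h unitInterval.nonneg')
    simp [splice, this]
  unfold vint
  congr 1 <;> refine integral_congr_ae ?_ <;> filter_upwards [h] with x hx <;> rw [hx]

theorem splice_one (θ : ℝ) (f g : unitInterval → ℝ × ℝ) : splice θ f g (1, 1) = f := by
  ext1 x
  have : x ≤ 1 := unitInterval.le_one'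
  simp [splice, this]

-- The planar Lyapunov argument. Replacing `g` by `f` gains in direction `θ` on the favorable set
-- and loses off it. The pairs of thresholds for which gain and loss cancel form a connected set
-- joining `(0, 0)`, where the splice is `g` almost everywhere, to `(1, 1)`, where it is `f`. Along
-- this set the integral stays on the line through `u` orthogonal to `θ`, and by the intermediate
-- value theorem it meets `u`.
open Classical in
theorem exists_vint_splice_eq [NullSingletonClass μ] {θ : ℝ} {f g : unitInterval → ℝ × ℝ} {u : ℝ × ℝ}
    (hf : Measurable f) (hg : Measurable g) (hfb : ∀ x, f x ∈ Set.Icc (0 : ℝ × ℝ) 1)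
    (hgb : ∀ x, g x ∈ Set.Icc (0 : ℝ × ℝ) 1) (hfu : proj θ (vint μ f) = proj θ u)
    (hgu : proj θ (vint μ g) = proj θ u)
    (hlo : proj (θ + Real.pi / 2) (vint μ g) ≤ proj (θ + Real.pi / 2) u)
    (hhi : proj (θ + Real.pi / 2) u ≤ proj (θ + Real.pi / 2) (vint μ f)) :
    ∃ z, vint μ (splice θ f g z) = u := by
  have hD := measurableSet_favorable (θ := θ) hf hg
  set D := favorable θ f g with hDdef
  set k : unitInterval → ℝ := fun x => proj θ (f x) - proj θ (g x) with hk
  have hkm : Measurable k := (measurable_proj measurable_const hf).sub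
    (measurable_proj measurable_const hg)
  have hkB : ∀ x, |k x| ≤ 4 := fun x => (abs_sub _ _).trans (by
    linarith [abs_proj_le (θ := θ) (hfb x), abs_proj_le (θ := θ) (hgb x)])
  have hkD : ∀ x ∈ D, 0 ≤ k x := fun x hx => sub_nonneg.2 hx
  have hkD' : ∀ x ∉ D, k x ≤ 0 := fun x hx => sub_nonpos.2 (not_le.1 hx).le
  have hkm' : Measurable fun x => - k x := hkm.neg
  have hkB' : ∀ x, |-k x| ≤ 4 := fun x => by simpa using hkB x
  obtain ⟨E, hE⟩ : ∃ E, E = Dᶜ := ⟨_, rfl⟩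
  have hEm : MeasurableSet E := hE ▸ hD.compl
  -- `P` is the accumulated gain on the favorable set, `N` the accumulated loss on its complement;
  -- both are continuous and monotone.
  set P : unitInterval → ℝ := fun r => ∫ x, (if x ∈ D ∧ x ≤ r then k x else 0) ∂μ with hP
  set N : unitInterval → ℝ := fun r => ∫ x, (if x ∈ E ∧ x ≤ r then - k x else 0) ∂μ with hN
  have hPi := integrable_primitive (μ := μ) hD hkm 4 hkB
  have hNi := integrable_primitive (μ := μ) hEm hkm' 4 hkB'
  have hPc : Continuous P := continuous_primitive hD hkm 4 hkB
  have hNc : Continuous N := continuous_primitive hEm hkm' 4 hkB'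
  have hPmono : Monotone P := monotone_primitive hD hkm 4 hkB hkD
  have hNmono : Monotone N := monotone_primitive hEm hkm' 4 hkB'
    fun x hx => neg_nonneg.2 (hkD' x (by simpa [hE] using hx))
  have hkey : ∀ z, proj θ (vint μ (splice θ f g z)) = proj θ u + (P z.1 - N z.2) := by
    intro z
    have e : ∀ x, proj θ (splice θ f g z x) = proj θ (g x) +
        ((if x ∈ D ∧ x ≤ z.1 then k x else 0) - if x ∈ E ∧ x ≤ z.2 then - k x else 0) := by
      intro x
      simp only [splice, ← hDdef, hE, Set.mem_compl_iff]
      by_cases hx : x ∈ D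
      · by_cases h1 : x ≤ z.1 <;> simp [hx, h1, hk]
      · by_cases h2 : x ≤ z.2 <;> simp [hx, h2, hk]
    rw [proj_vint (measurable_splice_apply hf hg z) (splice_mem_box hfb hgb), ← hgu,
      proj_vint hg hgb]
    simp only [e]
    have h1 := integral_sub (hPi z.1) (hNi z.2)
    have h2 := integral_add (integrable_proj hg hgb θ) ((hPi z.1).sub (hNi z.2))
    simp only [Pi.sub_apply] at h2
    rw [h2, h1]
  have h00 : P 0 = N 0 := by
    have := hkey (0, 0)
    rw [vint_splice_zero, hgu] at this
    simp only at this
    linarith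
  have h11 : P 1 = N 1 := by
    have := hkey (1, 1)
    rw [splice_one, hfu] at this
    simp only at this
    linarith
  have hpre := isPreconnected_level hPc hNc hNmono fun r =>
    ⟨h00.symm.le.trans (hPmono unitInterval.nonneg'), (hPmono unitInterval.le_one').trans h11.le⟩
  have hval : Continuous fun z => proj (θ + Real.pi / 2) (vint μ (splice θ f g z)) :=
    (continuous_proj_right _).comp (continuous_vint_splice hf hg hfb hgb)
  have hivt := hpre.intermediate_value (a := (0, 0)) (b := (1, 1)) h00 h11 hval.continuousOn
  have hu : proj (θ + Real.pi / 2) u ∈ Set.Icc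
      (proj (θ + Real.pi / 2) (vint μ (splice θ f g ((0, 0) : unitInterval × unitInterval))))
      (proj (θ + Real.pi / 2) (vint μ (splice θ f g ((1, 1) : unitInterval × unitInterval)))) := by
    rw [vint_splice_zero, splice_one]
    exact ⟨hlo, hhi⟩
  obtain ⟨z, hz, hzu⟩ := hivt hu
  refine ⟨z, eq_of_proj_eq (θ := θ) ?_ hzu⟩
  rw [hkey, show P z.1 = N z.2 from hz, sub_self, add_zero]

theorem measurable_vint {Y : Type*} [MeasurableSpace Y] {f : Y → unitInterval → ℝ × ℝ}
    (hf : Measurable fun p : Y × unitInterval => f p.1 p.2) :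
    Measurable fun y => vint μ (f y) :=
  (hf.fst.stronglyMeasurable.integral_prod_right').measurable.prodMk
    (hf.snd.stronglyMeasurable.integral_prod_right').measurable

/-- Two families of functions whose integrals lie on the line through `u y` orthogonal to `θ y`, on
different sides of `u y`, can be spliced measurably to a family with integrals `u y`. -/
theorem exists_measurable_splice [NullSingletonClass μ] {Y : Type*} [MeasurableSpace Y] {θ : Y → ℝ}
    {f g : Y → unitInterval → ℝ × ℝ} {u : Y → ℝ × ℝ} (hθ : Measurable θ) (hu : Measurable u)
    (hf : Measurable fun p : Y × unitInterval => f p.1 p.2)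
    (hg : Measurable fun p : Y × unitInterval => g p.1 p.2)
    (hfb : ∀ y x, f y x ∈ Set.Icc (0 : ℝ × ℝ) 1) (hgb : ∀ y x, g y x ∈ Set.Icc (0 : ℝ × ℝ) 1)
    (hfu : ∀ y, proj (θ y) (vint μ (f y)) = proj (θ y) (u y))
    (hgu : ∀ y, proj (θ y) (vint μ (g y)) = proj (θ y) (u y))
    (hlo : ∀ y, proj (θ y + Real.pi / 2) (vint μ (g y)) ≤ proj (θ y + Real.pi / 2) (u y))
    (hhi : ∀ y, proj (θ y + Real.pi / 2) (u y) ≤ proj (θ y + Real.pi / 2) (vint μ (f y))) :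
    ∃ w : Y → unitInterval → ℝ × ℝ, (Measurable fun p : Y × unitInterval => w p.1 p.2) ∧
      (∀ y x, w y x = f y x ∨ w y x = g y x) ∧ ∀ y, vint μ (w y) = u y := by
  have hfm : ∀ y, Measurable (f y) := fun y => hf.comp measurable_prodMk_left
  have hgm : ∀ y, Measurable (g y) := fun y => hg.comp measurable_prodMk_left
  obtain ⟨z, hz, hz0⟩ := exists_measurable_zero (C := (Set.univ : Set (unitInterval × unitInterval)))
    isCompact_univ (Φ := fun y z => dist (vint μ (splice (θ y) (f y) (g y) z)) (u y))
    (fun z => (measurable_vint (measurable_splice hθ hf hg measurable_const)).dist hu)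
    (fun y => (continuous_vint_splice (hfm y) (hgm y) (hfb y) (hgb y)).dist continuous_const)
    (fun _ _ => dist_nonneg) (fun y => by
      obtain ⟨z, hz⟩ := exists_vint_splice_eq (hfm y) (hgm y) (hfb y) (hgb y) (hfu y) (hgu y)
        (hlo y) (hhi y)
      exact ⟨z, trivial, dist_eq_zero.2 hz⟩)
  exact ⟨fun y => splice (θ y) (f y) (g y) (z y), measurable_splice hθ hf hg hz,
    fun y x => splice_eq_or _ _ _ _ _, fun y => dist_eq_zero.1 (hz0 y).2⟩

end Splice

/-! ### The integral of a compact-valued correspondence with values in the plane -/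

section Aumann

open Filter Topology

variable {μ : Measure unitInterval} [IsProbabilityMeasure μ]
variable {G : Set (unitInterval × (ℝ × ℝ))} {s t : ℝ → unitInterval → ℝ × ℝ} {κ : ℝ}

/-- `s θ` selects from the correspondence with graph `G` the point that is extreme in the direction
`θ` and, among these, extreme in the direction orthogonal to `θ` (with orientation `κ`). -/
structure IsFaceSelection (G : Set (unitInterval × (ℝ × ℝ))) (κ : ℝ)
    (s : ℝ → unitInterval → ℝ × ℝ) : Prop where
  measurable : Measurable fun p : ℝ × unitInterval => s p.1 p.2
  mem : ∀ θ x, (x, s θ x) ∈ G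
  le : ∀ θ x z, (x, z) ∈ G → proj θ z ≤ proj θ (s θ x)
  tie : ∀ θ x z, (x, z) ∈ G → proj θ z = proj θ (s θ x) →
    κ * proj (θ + Real.pi / 2) z ≤ κ * proj (θ + Real.pi / 2) (s θ x)

theorem isCompact_box : IsCompact (Set.Icc (0 : ℝ × ℝ) 1) := isCompact_Icc

/-- A lexicographic maximum: `a` maximizes in direction `θ`, then `b` maximizes in the orthogonal
direction among the points as good as `a`. Membership in `G` is encoded as a zero of the distance to
`G`, so that the selection theorem applies with the pair `(θ, x)` as parameter. -/
theorem exists_isFaceSelection (hG : IsClosed G) (hbox : ∀ p ∈ G, p.2 ∈ Set.Icc (0 : ℝ × ℝ) 1)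
    (hne : ∀ x, ∃ z, (x, z) ∈ G) (κ : ℝ) : ∃ s, IsFaceSelection G κ s := by
  have hGne : G.Nonempty := ⟨_, (hne 0).choose_spec⟩
  have hzero : ∀ x z, Metric.infDist (x, z) G = 0 ↔ (x, z) ∈ G := fun x z =>
    (hG.mem_iff_infDist_zero hGne).symm
  have hm : ∀ z : ℝ × ℝ, Measurable fun y : ℝ × unitInterval => Metric.infDist (y.2, z) G :=
    fun z => (Metric.continuous_infDist_pt G).measurable.comp (by fun_prop)
  have hc : ∀ y : ℝ × unitInterval, Continuous fun z : ℝ × ℝ => Metric.infDist (y.2, z) G :=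
    fun y => (Metric.continuous_infDist_pt G).comp (by fun_prop)
  obtain ⟨a, ham, ha, haM, hamax⟩ := exists_measurable_argmax isCompact_box
    (Φ := fun (y : ℝ × unitInterval) z => Metric.infDist (y.2, z) G)
    (ψ := fun y z => proj y.1 z) hm hc (fun _ _ => Metric.infDist_nonneg)
    (fun y => by
      obtain ⟨z, hz⟩ := hne y.2
      exact ⟨z, hbox _ hz, (hzero _ _).2 hz⟩)
    (fun z => measurable_proj measurable_fst measurable_const) (fun y => continuous_proj_right _)
  obtain ⟨b, hbm, hb, -, hbmax⟩ := exists_measurable_argmax isCompact_box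
    (Φ := fun (y : ℝ × unitInterval) z =>
      Metric.infDist (y.2, z) G + |proj y.1 z - proj y.1 (a y)|)
    (ψ := fun y z => κ * proj (y.1 + Real.pi / 2) z)
    (fun z => (hm z).add ((measurable_proj measurable_fst measurable_const).sub haM).abs)
    (fun y => (hc y).add ((continuous_proj_right _).sub continuous_const).abs)
    (fun _ _ => add_nonneg Metric.infDist_nonneg (abs_nonneg _))
    (fun y => ⟨a y, (ha y).1, by simp [(ha y).2]⟩)
    (fun z => (measurable_proj (measurable_fst.add_const _) measurable_const).const_mul κ)
    (fun y => continuous_const.mul (continuous_proj_right _))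
  have hb' : ∀ y : ℝ × unitInterval, (y.2, b y) ∈ G ∧ proj y.1 (b y) = proj y.1 (a y) := by
    intro y
    have h1 := (hb y).2
    have h2 : 0 ≤ Metric.infDist (y.2, b y) G := Metric.infDist_nonneg
    have h3 := abs_nonneg (proj y.1 (b y) - proj y.1 (a y))
    refine ⟨(hzero _ _).1 (by linarith), ?_⟩
    have : |proj y.1 (b y) - proj y.1 (a y)| = 0 := by linarith
    linarith [abs_eq_zero.1 this]
  refine ⟨fun θ x => b (θ, x), hbm, fun θ x => (hb' (θ, x)).1, fun θ x z hz => ?_,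
    fun θ x z hz h => ?_⟩
  · rw [(hb' (θ, x)).2]
    exact hamax (θ, x) z (hbox _ hz) ((hzero _ _).2 hz)
  · refine hbmax (θ, x) z (hbox _ hz) ?_
    rw [(hb' (θ, x)).2] at h
    simp [(hzero _ _).2 hz, h]

namespace IsFaceSelection

theorem measurable_right (hs : IsFaceSelection G κ s) (θ : ℝ) : Measurable (s θ) :=
  hs.measurable.comp measurable_prodMk_left

theorem mem_box (hs : IsFaceSelection G κ s) (hbox : ∀ p ∈ G, p.2 ∈ Set.Icc (0 : ℝ × ℝ) 1)
    (θ : ℝ) (x : unitInterval) : s θ x ∈ Set.Icc (0 : ℝ × ℝ) 1 :=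
  hbox _ (hs.mem θ x)

theorem proj_vint_le (hs : IsFaceSelection G κ s) (hbox : ∀ p ∈ G, p.2 ∈ Set.Icc (0 : ℝ × ℝ) 1)
    {w : unitInterval → ℝ × ℝ} (hw : Measurable w) (hwG : ∀ x, (x, w x) ∈ G) (θ : ℝ) :
    proj θ (vint μ w) ≤ proj θ (vint μ (s θ)) := by
  have hwb : ∀ x, w x ∈ Set.Icc (0 : ℝ × ℝ) 1 := fun x => hbox _ (hwG x)
  rw [proj_vint hw hwb, proj_vint (hs.measurable_right θ) (hs.mem_box hbox θ)]
  exact integral_mono (integrable_proj hw hwb θ)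
    (integrable_proj (hs.measurable_right θ) (hs.mem_box hbox θ) θ)
    fun x => hs.le θ x _ (hwG x)

/-- Rotating the direction to `θ` from the side `κ`, the maximizers converge to the endpoint of the
face on that side. By compactness it suffices to identify cluster points: such a point lies in the
face, and it is at least as far to the side `κ` as `t θ x`, since any maximizer in a rotated
direction is. How `s` breaks ties is irrelevant. -/
theorem tendsto_rotate (hG : IsClosed G) (hbox : ∀ p ∈ G, p.2 ∈ Set.Icc (0 : ℝ × ℝ) 1)
    (hκ : κ = 1 ∨ κ = -1) {κ' : ℝ} (hs : IsFaceSelection G κ' s) (ht : IsFaceSelection G κ t)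
    (θ : ℝ) (x : unitInterval) :
    Tendsto (fun ε => s (θ + κ * ε) x) (𝓝[>] 0) (𝓝 (t θ x)) := by
  have hsin : ∀ ε, Real.sin (κ * ε) = κ * Real.sin ε := by
    rcases hκ with rfl | rfl <;> simp
  have hcos : ∀ ε, Real.cos (κ * ε) = Real.cos ε := by
    rcases hκ with rfl | rfl <;> simp
  have hev : ∀ᶠ ε : ℝ in 𝓝[>] 0, 0 < Real.sin ε ∧ 0 < Real.cos ε := by
    have : Set.Ioo (0 : ℝ) (Real.pi / 2) ∈ 𝓝[>] (0 : ℝ) :=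
      Ioo_mem_nhdsGT (by positivity)
    filter_upwards [this] with ε hε
    exact ⟨Real.sin_pos_of_pos_of_lt_pi hε.1 (by linarith [hε.2, Real.pi_pos]),
      Real.cos_pos_of_mem_Ioo ⟨by linarith [hε.1, Real.pi_pos], hε.2⟩⟩
  have hmax : ∀ ε, Real.cos ε * proj θ (t θ x) + Real.sin ε * (κ * proj (θ + Real.pi / 2) (t θ x)) ≤
      Real.cos ε * proj θ (s (θ + κ * ε) x) +
        Real.sin ε * (κ * proj (θ + Real.pi / 2) (s (θ + κ * ε) x)) := by
    intro ε
    have := hs.le (θ + κ * ε) x _ (ht.mem θ x)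
    rw [proj_add θ (κ * ε), proj_add θ (κ * ε), hsin, hcos] at this
    linarith
  have hle : ∀ ε, proj θ (s (θ + κ * ε) x) ≤ proj θ (t θ x) := fun ε =>
    ht.le θ x _ (hs.mem _ _)
  refine isCompact_box.tendsto_nhds_of_unique_mapClusterPt
    (Eventually.of_forall fun ε => hs.mem_box hbox _ _) fun z _ hz => ?_
  have hzG : (x, z) ∈ G := by
    have hcl : IsClosed {z | (x, z) ∈ G} := hG.preimage (by fun_prop)
    exact hcl.mem_of_mapClusterPt hz (Eventually.of_forall fun ε => hs.mem _ _)
  have horth : κ * proj (θ + Real.pi / 2) (t θ x) ≤ κ * proj (θ + Real.pi / 2) z := by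
    have hcl : IsClosed {z | κ * proj (θ + Real.pi / 2) (t θ x) ≤ κ * proj (θ + Real.pi / 2) z} :=
      isClosed_le continuous_const (continuous_const.mul (continuous_proj_right _))
    refine hcl.mem_of_mapClusterPt hz ?_
    filter_upwards [hev] with ε hε
    have h1 := hmax ε
    have h2 := mul_le_mul_of_nonneg_left (hle ε) hε.2.le
    exact le_of_mul_le_mul_left (by linarith) hε.1
  have hface : proj θ (t θ x) ≤ proj θ z := by
    refine le_of_forall_pos_le_add fun δ hδ => ?_
    have hcl : IsClosed {z | proj θ (t θ x) ≤ proj θ z + δ} :=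
      isClosed_le continuous_const ((continuous_proj_right _).add continuous_const)
    refine hcl.mem_of_mapClusterPt hz ?_
    -- This lower bound for `proj θ (s (θ + κ * ε) x)` comes from `hmax`: the two orthogonal
    -- components differ by at most 4, and dropping the factor `cos ε` costs at most `2 * (1 - cos
    -- ε)`.
    have hlim : Tendsto (fun ε => Real.cos ε * proj θ (t θ x) - 4 * Real.sin ε +
        2 * Real.cos ε - 2) (𝓝[>] 0) (𝓝 (proj θ (t θ x))) := by
      have : Continuous fun ε => Real.cos ε * proj θ (t θ x) - 4 * Real.sin ε +
        2 * Real.cos ε - 2 := by fun_prop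
      simpa using (this.tendsto 0).mono_left nhdsWithin_le_nhds
    filter_upwards [hev, hlim.eventually (lt_mem_nhds (show proj θ (t θ x) - δ < _ by linarith))]
      with ε hε hlt
    have h1 := hmax ε
    have h3 := abs_le.1 (abs_proj_le (θ := θ) (hs.mem_box hbox (θ + κ * ε) x))
    have h4 := abs_le.1 (abs_proj_le (θ := θ + Real.pi / 2) (hs.mem_box hbox (θ + κ * ε) x))
    have h5 := abs_le.1 (abs_proj_le (θ := θ + Real.pi / 2) (ht.mem_box hbox θ x))
    have hc1 := Real.cos_le_one ε
    have hs1 := hε.1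
    show proj θ (t θ x) ≤ proj θ (s (θ + κ * ε) x) + δ
    have h6 : κ * proj (θ + Real.pi / 2) (s (θ + κ * ε) x) ≤ 2 := by
      rcases hκ with rfl | rfl <;> linarith
    have h7 : -2 ≤ κ * proj (θ + Real.pi / 2) (t θ x) := by
      rcases hκ with rfl | rfl <;> linarith
    nlinarith [mul_le_mul_of_nonneg_left h6 hs1.le, mul_le_mul_of_nonneg_left h7 hs1.le,
      mul_nonneg (sub_nonneg.2 hc1) (show 0 ≤ 2 + proj θ (s (θ + κ * ε) x) by linarith)]
  have hface' := le_antisymm (ht.le θ x z hzG) hface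
  refine eq_of_proj_eq hface' ?_
  have := le_antisymm (ht.tie θ x z hzG hface') horth
  exact mul_left_cancel₀ (by rcases hκ with rfl | rfl <;> norm_num) this

theorem tendsto_vint_rotate (hG : IsClosed G) (hbox : ∀ p ∈ G, p.2 ∈ Set.Icc (0 : ℝ × ℝ) 1)
    (hκ : κ = 1 ∨ κ = -1) {κ' : ℝ} (hs : IsFaceSelection G κ' s) (ht : IsFaceSelection G κ t)
    (θ : ℝ) :
    Tendsto (fun ε => vint μ (s (θ + κ * ε))) (𝓝[>] 0) (𝓝 (vint μ (t θ))) := by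
  have hb := fun ε x => hs.mem_box hbox (θ + κ * ε) x
  refine Tendsto.prodMk_nhds ?_ ?_
  · refine tendsto_integral_filter_of_dominated_convergence (fun _ => 1) ?_ ?_
      (integrable_const _) ?_
    · exact Eventually.of_forall fun ε => (hs.measurable_right _).fst.aestronglyMeasurable
    · exact Eventually.of_forall fun ε => Eventually.of_forall fun x => abs_le.2
        ⟨by linarith [show (0 : ℝ) ≤ _ from (hb ε x).1.1], (hb ε x).2.1⟩
    · exact Eventually.of_forall fun x =>
        (continuous_fst.tendsto _).comp (tendsto_rotate hG hbox hκ hs ht θ x)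
  · refine tendsto_integral_filter_of_dominated_convergence (fun _ => 1) ?_ ?_
      (integrable_const _) ?_
    · exact Eventually.of_forall fun ε => (hs.measurable_right _).snd.aestronglyMeasurable
    · exact Eventually.of_forall fun ε => Eventually.of_forall fun x => abs_le.2
        ⟨by linarith [show (0 : ℝ) ≤ _ from (hb ε x).1.2], (hb ε x).2.2⟩
    · exact Eventually.of_forall fun x =>
        (continuous_snd.tendsto _).comp (tendsto_rotate hG hbox hκ hs ht θ x)

end IsFaceSelection

/-- The convex set with support function `θ ↦ proj θ (∫ s θ)`. -/
def supportedSet (μ : Measure unitInterval) (s : ℝ → unitInterval → ℝ × ℝ) : Set (ℝ × ℝ) :=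
  {y | ∀ θ, proj θ y ≤ proj θ (vint μ (s θ))}

omit [IsProbabilityMeasure μ] in
theorem isClosed_supportedSet : IsClosed (supportedSet μ s) := by
  have : supportedSet μ s = ⋂ θ, {y | proj θ y ≤ proj θ (vint μ (s θ))} := by
    ext; simp [supportedSet]
  rw [this]
  exact isClosed_iInter fun θ => isClosed_le (continuous_proj_right θ) continuous_const

omit [IsProbabilityMeasure μ] in
theorem convex_supportedSet : Convex ℝ (supportedSet μ s) := by
  intro y hy z hz a b ha hb hab θ
  have e : proj θ (a • y + b • z) = a * proj θ y + b * proj θ z := by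
    simp only [proj, Prod.fst_add, Prod.snd_add, Prod.smul_fst, Prod.smul_snd, smul_eq_mul]
    ring
  rw [e]
  have h1 := mul_le_mul_of_nonneg_left (hy θ) ha
  have h2 := mul_le_mul_of_nonneg_left (hz θ) hb
  have : proj θ (vint μ (s θ)) = a * proj θ (vint μ (s θ)) + b * proj θ (vint μ (s θ)) := by
    rw [← add_mul, hab, one_mul]
  linarith

/-- The four coordinate directions give the four sides of the square. -/
theorem supportedSet_subset_box (hs : IsFaceSelection G κ s)
    (hbox : ∀ p ∈ G, p.2 ∈ Set.Icc (0 : ℝ × ℝ) 1) :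
    supportedSet μ s ⊆ Set.Icc (0 : ℝ × ℝ) 1 := by
  intro y hy
  have hb := fun θ => vint_mem_box (μ := μ) (hs.measurable_right θ) (hs.mem_box hbox θ)
  have h0 := hy 0
  have h1 := hy (Real.pi / 2)
  have h2 := hy Real.pi
  have h3 := hy (-(Real.pi / 2))
  simp only [proj, Real.cos_zero, Real.sin_zero, Real.cos_pi_div_two, Real.sin_pi_div_two,
    Real.cos_pi, Real.sin_pi, Real.cos_neg, Real.sin_neg] at h0 h1 h2 h3
  have e0 := (hb 0).2.1
  have e1 := (hb (Real.pi / 2)).2.2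
  have e2 := (hb Real.pi).1.1
  have e3 := (hb (-(Real.pi / 2))).1.2
  simp only [Prod.fst_zero, Prod.snd_zero, Prod.fst_one, Prod.snd_one] at e0 e1 e2 e3
  exact ⟨⟨by simp only [Prod.fst_zero]; linarith, by simp only [Prod.snd_zero]; linarith⟩,
    by simp only [Prod.fst_one]; linarith, by simp only [Prod.snd_one]; linarith⟩

/-- The face in direction `θ` extends no further than the integral of the extreme selection. Compare
`b` with the integral of `s` in the direction `θ + κ * ε`: since `b` is maximal in direction `θ`, it
cannot be ahead in the orthogonal component. Then let `ε` tend to 0. -/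
theorem face_le (hG : IsClosed G) (hbox : ∀ p ∈ G, p.2 ∈ Set.Icc (0 : ℝ × ℝ) 1)
    (hκ : κ = 1 ∨ κ = -1) {κ' : ℝ} (hs : IsFaceSelection G κ' s) (ht : IsFaceSelection G κ t)
    {b : ℝ × ℝ} (hb : b ∈ supportedSet μ s) {θ : ℝ} (hθ : proj θ b = proj θ (vint μ (s θ))) :
    κ * proj (θ + Real.pi / 2) b ≤ κ * proj (θ + Real.pi / 2) (vint μ (t θ)) := by
  have hlim : Tendsto (fun ε => κ * proj (θ + Real.pi / 2) (vint μ (s (θ + κ * ε)))) (𝓝[>] 0)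
      (𝓝 (κ * proj (θ + Real.pi / 2) (vint μ (t θ)))) :=
    ((continuous_const.mul (continuous_proj_right _)).tendsto _).comp
      (IsFaceSelection.tendsto_vint_rotate hG hbox hκ hs ht θ)
  refine ge_of_tendsto hlim ?_
  have : Set.Ioo (0 : ℝ) (Real.pi / 2) ∈ 𝓝[>] (0 : ℝ) := Ioo_mem_nhdsGT (by positivity)
  filter_upwards [this] with ε hε
  have hsin := Real.sin_pos_of_pos_of_lt_pi hε.1 (by linarith [hε.2, Real.pi_pos])
  have hcos := Real.cos_pos_of_mem_Ioo ⟨by linarith [hε.1, Real.pi_pos], hε.2⟩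
  have hsin' : Real.sin (κ * ε) = κ * Real.sin ε := by
    rcases hκ with rfl | rfl <;> simp
  have hcos' : Real.cos (κ * ε) = Real.cos ε := by
    rcases hκ with rfl | rfl <;> simp
  have h1 := hb (θ + κ * ε)
  rw [proj_add θ (κ * ε), proj_add θ (κ * ε), hsin', hcos', hθ] at h1
  have h2 := mul_le_mul_of_nonneg_left (hs.proj_vint_le (μ := μ) hbox
    (hs.measurable_right (θ + κ * ε)) (hs.mem _) θ) hcos.le
  exact le_of_mul_le_mul_left (by linarith) hsin

theorem continuous_support (hs : IsFaceSelection G κ s)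
    (hbox : ∀ p ∈ G, p.2 ∈ Set.Icc (0 : ℝ × ℝ) 1) :
    Continuous fun θ => proj θ (vint μ (s θ)) := by
  have hle : ∀ θ θ', proj θ (vint μ (s θ)) ≤ proj θ' (vint μ (s θ')) +
      (|Real.cos θ - Real.cos θ'| + |Real.sin θ - Real.sin θ'|) := by
    intro θ θ'
    have h1 := hs.proj_vint_le (μ := μ) hbox (hs.measurable_right θ) (hs.mem θ) θ'
    obtain ⟨⟨hb1, hb2⟩, hb3, hb4⟩ :=
      vint_mem_box (μ := μ) (hs.measurable_right θ) (hs.mem_box hbox θ)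
    simp only [Prod.fst_zero, Prod.snd_zero, Prod.fst_one, Prod.snd_one] at hb1 hb2 hb3 hb4
    have h2 : proj θ (vint μ (s θ)) - proj θ' (vint μ (s θ)) =
      (Real.cos θ - Real.cos θ') * (vint μ (s θ)).1 +
        (Real.sin θ - Real.sin θ') * (vint μ (s θ)).2 := by unfold proj; ring
    have h3 : (Real.cos θ - Real.cos θ') * (vint μ (s θ)).1 ≤ |Real.cos θ - Real.cos θ'| :=
      (mul_le_mul_of_nonneg_right (le_abs_self _) hb1).trans
        (mul_le_of_le_one_right (abs_nonneg _) hb3)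
    have h4 : (Real.sin θ - Real.sin θ') * (vint μ (s θ)).2 ≤ |Real.sin θ - Real.sin θ'| :=
      (mul_le_mul_of_nonneg_right (le_abs_self _) hb2).trans
        (mul_le_of_le_one_right (abs_nonneg _) hb4)
    linarith
  rw [continuous_iff_continuousAt]
  intro θ₀
  have hz : Tendsto (fun θ => |Real.cos θ - Real.cos θ₀| + |Real.sin θ - Real.sin θ₀|) (𝓝 θ₀)
      (𝓝 0) := by
    have : Continuous fun θ => |Real.cos θ - Real.cos θ₀| + |Real.sin θ - Real.sin θ₀| := by
      fun_prop
    simpa using this.tendsto θ₀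
  refine tendsto_iff_dist_tendsto_zero.2 (squeeze_zero (fun _ => dist_nonneg) (fun θ => ?_) hz)
  rw [Real.dist_eq, abs_sub_le_iff]
  have h1 := hle θ θ₀
  have h2 := hle θ₀ θ
  rw [abs_sub_comm (Real.cos θ₀), abs_sub_comm (Real.sin θ₀)] at h2
  constructor <;> linarith

/-- The selections at `θ` and `θ + 2π` are not assumed equal, but both are optimal in the same
direction. Periodicity lets compactness of `[0, 2π]` control all directions. -/
theorem support_periodic (hs : IsFaceSelection G κ s)
    (hbox : ∀ p ∈ G, p.2 ∈ Set.Icc (0 : ℝ × ℝ) 1) :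
    Function.Periodic (fun θ => proj θ (vint μ (s θ))) (2 * Real.pi) := by
  have hp : ∀ θ z, proj (θ + 2 * Real.pi) z = proj θ z := fun θ z => by simp [proj]
  intro θ
  refine le_antisymm ?_ ?_ <;> dsimp only
  · rw [hp]
    exact hs.proj_vint_le hbox (hs.measurable_right _) (hs.mem _) θ
  · rw [← hp θ]
    exact hs.proj_vint_le hbox (hs.measurable_right _) (hs.mem _) _

/-- Moving vertically from a point of the set one reaches a boundary point. -/
theorem exists_boundary (hs : IsFaceSelection G κ s)
    (hbox : ∀ p ∈ G, p.2 ∈ Set.Icc (0 : ℝ × ℝ) 1) {δ : ℝ} (hδ : δ = 1 ∨ δ = -1) {y : ℝ × ℝ}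
    (hy : y ∈ supportedSet μ s) :
    ∃ z ∈ Set.Icc (0 : ℝ) 1 ×ˢ Set.Icc (0 : ℝ) (2 * Real.pi),
      y + (0, δ * z.1) ∈ supportedSet μ s ∧
      proj z.2 (y + (0, δ * z.1)) = proj z.2 (vint μ (s z.2)) := by
  have hcont : Continuous fun τ : ℝ => y + ((0, δ * τ) : ℝ × ℝ) := by fun_prop
  -- The longest admissible vertical shift is taken; if no direction were tight there, the smallest
  -- gap `ε` over all directions would be positive and a further shift by `ε` possible.
  have hcpt : IsCompact (Set.Icc (0 : ℝ) 1 ∩ {τ | y + ((0, δ * τ) : ℝ × ℝ) ∈ supportedSet μ s}) :=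
    isCompact_Icc.inter_right (isClosed_supportedSet.preimage hcont)
  obtain ⟨τ, ⟨hτ, hτK⟩, hτmax⟩ := hcpt.exists_isMaxOn ⟨0, by simp, by simpa [← Prod.zero_eq_mk] using hy⟩
    continuousOn_id
  set b := y + ((0, δ * τ) : ℝ × ℝ) with hb
  have hbK : b ∈ supportedSet μ s := hτK
  have hgap : Continuous fun θ => proj θ (vint μ (s θ)) - proj θ b :=
    (continuous_support hs hbox).sub (by unfold proj; fun_prop)
  obtain ⟨θ, hθ, hθmin⟩ := (isCompact_Icc (a := (0 : ℝ)) (b := 2 * Real.pi)).exists_isMinOn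
    ⟨0, by simp [Real.pi_pos.le]⟩ hgap.continuousOn
  refine ⟨(τ, θ), ⟨hτ, hθ⟩, hbK, ?_⟩
  by_contra hne
  have hpos : 0 < proj θ (vint μ (s θ)) - proj θ b :=
    sub_pos.2 (lt_of_le_of_ne (hbK θ) hne)
  set ε := proj θ (vint μ (s θ)) - proj θ b with hε
  -- A vertical shift by `ε` raises each projection by at most `ε`, because sines are at most 1 in
  -- absolute value.
  have hK : y + ((0, δ * (τ + ε)) : ℝ × ℝ) ∈ supportedSet μ s := by
    have hper : Function.Periodic (fun θ => proj θ (vint μ (s θ)) -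
        proj θ (y + ((0, δ * (τ + ε)) : ℝ × ℝ))) (2 * Real.pi) :=
      (support_periodic hs hbox).sub fun θ => by simp [proj]
    intro θ'
    obtain ⟨θ'', hθ'', heq⟩ := hper.exists_mem_Ico₀ Real.two_pi_pos θ'
    have h1 : ε ≤ proj θ'' (vint μ (s θ'')) - proj θ'' b := hθmin (Set.Ico_subset_Icc_self hθ'')
    have h2 : proj θ'' (y + ((0, δ * (τ + ε)) : ℝ × ℝ)) =
        proj θ'' b + δ * Real.sin θ'' * ε := by
      simp only [hb, proj, Prod.fst_add, Prod.snd_add]; ring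
    have h3 : δ * Real.sin θ'' ≤ 1 := by
      rcases hδ with rfl | rfl
      · linarith [Real.sin_le_one θ'']
      · linarith [Real.neg_one_le_sin θ'']
    have h4 : δ * Real.sin θ'' * ε ≤ ε := mul_le_of_le_one_left hpos.le h3
    linarith
  have hyb := supportedSet_subset_box hs hbox hy
  have hyb' := supportedSet_subset_box hs hbox hK
  have h1 : τ + ε ≤ 1 := by
    have a1 := hyb.1.2
    have a2 := hyb.2.2
    have a3 := hyb'.1.2
    have a4 := hyb'.2.2
    simp only [Prod.snd_zero, Prod.snd_one, Prod.snd_add] at a1 a2 a3 a4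
    rcases hδ with rfl | rfl <;> linarith
  have := hτmax (a := τ + ε) ⟨⟨by linarith [hτ.1], h1⟩, hK⟩
  simp only [id, Set.mem_ofPred_eq] at this
  linarith

/-- A measurable family of selections whose integrals are the boundary points vertically above or
below given points. -/
theorem exists_measurable_boundary [NullSingletonClass μ] (hG : IsClosed G)
    (hbox : ∀ p ∈ G, p.2 ∈ Set.Icc (0 : ℝ × ℝ) 1) (hs : IsFaceSelection G 1 s)
    (ht : IsFaceSelection G (-1) t) {δ : ℝ} (hδ : δ = 1 ∨ δ = -1) :
    ∃ w : supportedSet μ s → unitInterval → ℝ × ℝ,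
      (Measurable fun p : supportedSet μ s × unitInterval => w p.1 p.2) ∧
      (∀ y x, (x, w y x) ∈ G) ∧ ∀ y, (vint μ (w y)).1 = (y : ℝ × ℝ).1 ∧
        0 ≤ δ * ((vint μ (w y)).2 - (y : ℝ × ℝ).2) := by
  rcases (supportedSet μ s).eq_empty_or_nonempty with hemp | hKne
  · have : IsEmpty (supportedSet μ s) := Set.isEmpty_coe_sort.2 hemp
    exact ⟨isEmptyElim, measurable_of_empty _, fun y => isEmptyElim y, fun y => isEmptyElim y⟩
  have hKzero : ∀ b, Metric.infDist b (supportedSet μ s) = 0 ↔ b ∈ supportedSet μ s := fun b =>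
    (isClosed_supportedSet.mem_iff_infDist_zero hKne).symm
  obtain ⟨z, hzm, hz⟩ := exists_measurable_zero
    (C := Set.Icc (0 : ℝ) 1 ×ˢ Set.Icc (0 : ℝ) (2 * Real.pi)) (isCompact_Icc.prod isCompact_Icc)
    (Φ := fun (y : supportedSet μ s) z =>
      Metric.infDist ((y : ℝ × ℝ) + (0, δ * z.1)) (supportedSet μ s) +
        |proj z.2 ((y : ℝ × ℝ) + (0, δ * z.1)) - proj z.2 (vint μ (s z.2))|)
    (fun z => ((Metric.continuous_infDist_pt _).measurable.comp
      (measurable_subtype_coe.add_const _)).add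
      ((measurable_proj measurable_const (measurable_subtype_coe.add_const _)).sub
        measurable_const).abs)
    (fun y => ((Metric.continuous_infDist_pt _).comp (by fun_prop)).add
      (((continuous_proj.comp (g := fun p : ℝ × (ℝ × ℝ) => proj p.1 p.2)
        (f := fun z : ℝ × ℝ => (z.2, (y : ℝ × ℝ) + (0, δ * z.1))) (by fun_prop)).sub
        ((continuous_support hs hbox).comp continuous_snd)).abs))
    (fun _ _ => add_nonneg Metric.infDist_nonneg (abs_nonneg _))
    (fun y => by
      obtain ⟨z, hz, h1, h2⟩ := exists_boundary hs hbox hδ y.2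
      exact ⟨z, hz, by simp [(hKzero _).2 h1, h2]⟩)
  set b : supportedSet μ s → ℝ × ℝ := fun y => (y : ℝ × ℝ) + (0, δ * (z y).1) with hbdef
  have hbm : Measurable b := measurable_subtype_coe.add
    (measurable_const.prodMk (hzm.fst.const_mul _))
  have hb : ∀ y, b y ∈ supportedSet μ s ∧
      proj (z y).2 (b y) = proj (z y).2 (vint μ (s (z y).2)) := by
    intro y
    have h1 := (hz y).2
    have h2 : 0 ≤ Metric.infDist (b y) (supportedSet μ s) := Metric.infDist_nonneg
    have h3 := abs_nonneg (proj (z y).2 (b y) - proj (z y).2 (vint μ (s (z y).2)))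
    change Metric.infDist (b y) (supportedSet μ s) +
      |proj (z y).2 (b y) - proj (z y).2 (vint μ (s (z y).2))| = 0 at h1
    refine ⟨(hKzero _).1 (by linarith), ?_⟩
    have : |proj (z y).2 (b y) - proj (z y).2 (vint μ (s (z y).2))| = 0 := by linarith
    linarith [abs_eq_zero.1 this]
  have hst : ∀ θ, proj θ (vint μ (t θ)) = proj θ (vint μ (s θ)) := fun θ =>
    le_antisymm (hs.proj_vint_le hbox (ht.measurable_right θ) (ht.mem θ) θ)
      (ht.proj_vint_le hbox (hs.measurable_right θ) (hs.mem θ) θ)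
  have hpair : Measurable fun p : supportedSet μ s × unitInterval => ((z p.1).2, p.2) :=
    (hzm.snd.comp measurable_fst).prodMk measurable_snd
  -- The boundary point `b y` lies on a face whose two ends are the integrals of `s` and `t`;
  -- splicing these reaches it.
  obtain ⟨w, hwm, hw, hwv⟩ := exists_measurable_splice (μ := μ) (θ := fun y => (z y).2) (u := b)
    (f := fun y => s (z y).2) (g := fun y => t (z y).2) hzm.snd hbm
    (hs.measurable.comp hpair) (ht.measurable.comp hpair) (fun y => hs.mem_box hbox _)
    (fun y => ht.mem_box hbox _) (fun y => (hb y).2.symm) (fun y => (hst _).trans (hb y).2.symm)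
    (fun y => by
      have := face_le hG hbox (Or.inr rfl) hs ht (hb y).1 (hb y).2
      linarith)
    (fun y => by
      have := face_le hG hbox (Or.inl rfl) hs hs (hb y).1 (hb y).2
      linarith)
  refine ⟨w, hwm, fun y x => ?_, fun y => ?_⟩
  · rcases hw y x with h | h <;> rw [h]
    exacts [hs.mem _ _, ht.mem _ _]
  · rw [hwv]
    have h0 := (hz y).1.1.1
    simp only [hbdef, Prod.fst_add, add_zero, Prod.snd_add, add_sub_cancel_left, true_and]
    rcases hδ with rfl | rfl <;> linarith

/-- The integrals of the measurable selections of the correspondence with graph `G`. -/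
def integralSet (μ : Measure unitInterval) (G : Set (unitInterval × (ℝ × ℝ))) : Set (ℝ × ℝ) :=
  {y | ∃ w : unitInterval → ℝ × ℝ, Measurable w ∧ (∀ x, (x, w x) ∈ G) ∧ vint μ w = y}

/-- For an atomless law the integral of a correspondence with closed graph is compact and convex,
and its points are integrals of a measurable family of selections. -/
theorem integralSet_spec [NullSingletonClass μ] (hG : IsClosed G)
    (hbox : ∀ p ∈ G, p.2 ∈ Set.Icc (0 : ℝ × ℝ) 1) (hne : ∀ x, ∃ z, (x, z) ∈ G) :
    IsCompact (integralSet μ G) ∧ Convex ℝ (integralSet μ G) ∧ (integralSet μ G).Nonempty ∧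
      integralSet μ G ⊆ Set.Icc 0 1 ∧
      ∃ W : ℝ × ℝ → unitInterval → ℝ × ℝ,
        (Measurable fun p : (ℝ × ℝ) × unitInterval => W p.1 p.2) ∧ (∀ y x, (x, W y x) ∈ G) ∧
        ∀ y ∈ integralSet μ G, vint μ (W y) = y := by
  obtain ⟨s, hs⟩ := exists_isFaceSelection hG hbox hne 1
  obtain ⟨t, ht⟩ := exists_isFaceSelection hG hbox hne (-1)
  obtain ⟨f, hfm, hf, hfv⟩ := exists_measurable_boundary (μ := μ) hG hbox hs ht (Or.inl rfl)
  obtain ⟨g, hgm, hg, hgv⟩ := exists_measurable_boundary (μ := μ) hG hbox hs ht (Or.inr rfl)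
  have hp0 : ∀ z, proj 0 z = z.1 := fun z => by simp [proj]
  have hp1 : ∀ z, proj (0 + Real.pi / 2) z = z.2 := fun z => by simp [proj]
  -- With direction 0 the line in question is vertical, and the integrals of `f` and `g` lie on it
  -- above and below the target.
  obtain ⟨w, hwm, hw, hwv⟩ := exists_measurable_splice (μ := μ)
    (θ := fun _ : supportedSet μ s => 0) (u := Subtype.val) (f := f) (g := g) measurable_const
    measurable_subtype_coe hfm hgm (fun y x => hbox _ (hf y x)) (fun y x => hbox _ (hg y x))
    (fun y => by rw [hp0, hp0, (hfv y).1]) (fun y => by rw [hp0, hp0, (hgv y).1])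
    (fun y => by rw [hp1, hp1]; linarith [(hgv y).2])
    (fun y => by rw [hp1, hp1]; linarith [(hfv y).2])
  have hwG : ∀ y x, (x, w y x) ∈ G := fun y x => by
    rcases hw y x with h | h <;> rw [h]
    exacts [hf y x, hg y x]
  have heq : integralSet μ G = supportedSet μ s := by
    ext y
    constructor
    · rintro ⟨v, hv, hvG, rfl⟩ θ
      exact hs.proj_vint_le hbox hv hvG θ
    · intro hy
      exact ⟨w ⟨y, hy⟩, hwm.comp measurable_prodMk_left, hwG _, hwv ⟨y, hy⟩⟩
  have hmem : vint μ (s 0) ∈ supportedSet μ s :=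
    heq ▸ ⟨s 0, hs.measurable_right 0, hs.mem 0, rfl⟩
  have hsub := supportedSet_subset_box (μ := μ) hs hbox
  classical
  -- Targets outside the set are sent to a fixed point of it, so that `W` is defined, and selects
  -- from `G`, for every vector of the plane.
  set ret : ℝ × ℝ → supportedSet μ s := fun y =>
    if hy : y ∈ supportedSet μ s then ⟨y, hy⟩ else ⟨_, hmem⟩ with hret
  have hretm : Measurable ret :=
    Measurable.dite (s := supportedSet μ s) measurable_id measurable_const
      isClosed_supportedSet.measurableSet
  rw [heq]
  refine ⟨isCompact_box.of_isClosed_subset isClosed_supportedSet hsub, convex_supportedSet,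
    ⟨_, hmem⟩, hsub, fun y => w (ret y), ?_, fun y x => hwG _ _, fun y hy => ?_⟩
  · exact hwm.comp ((hretm.comp measurable_fst).prodMk measurable_snd)
  · rw [hwv]
    simp [hret, hy]

end Aumann

/-! ### Histories and stage expectations -/

section Basics

variable {t : ℕ} {h : History t} {r : StageRecord} {i j : Fin 2}

@[simp] theorem addStage_last (h : History t) (r : StageRecord) :
    addStage h r (Fin.last t) = r := by
  simp [addStage]

@[simp] theorem addStage_castSucc (h : History t) (r : StageRecord) (s : Fin t) :
    addStage h r s.castSucc = h s := by
  simp [addStage]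

theorem init_addStage (h : History t) (r : StageRecord) :
    Fin.init (α := fun _ => StageRecord) (addStage h r) = h := by
  simp [addStage]

theorem present_addStage :
    Present (addStage h r) i ↔ Present h i ∧ r.taker ≠ some i := by
  simp [Present, Fin.forall_fin_succ']

theorem receipts_addStage : receipts (addStage h r) i =
    receipts h i + if r.taker = some i then (r.sample : ℝ) else 0 := by
  simp [receipts, Fin.sum_univ_castSucc]

theorem receipts_of_present (hi : Present h i) : receipts h i = 0 := by
  refine Finset.sum_eq_zero fun s _ => ?_
  rw [if_neg (hi s)]

theorem receipts_nonneg : 0 ≤ receipts h i :=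
  Finset.sum_nonneg fun s _ => by
    split_ifs
    exacts [unitInterval.nonneg _, le_rfl]

theorem receipts_le : receipts h i ≤ t := by
  have : receipts h i ≤ ∑ _s : Fin t, (1 : ℝ) := Finset.sum_le_sum fun s _ => by
    split_ifs
    exacts [unitInterval.le_one _, zero_le_one]
  simpa using this

theorem feasible_addStage (hh : Feasible h) (h1 : ∀ i, r.bids i = true → Present h i)
    (h2 : ∀ i, r.taker = some i → r.bids i = true)
    (h3 : r.taker = none → ∀ i, r.bids i = false) : Feasible (addStage h r) := by
  intro s
  induction s using Fin.lastCases with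
  | last =>
    refine ⟨fun i hi s hs => ?_, fun i hi => ?_, fun hn => ?_⟩
    · rw [addStage_last] at hi
      induction s using Fin.lastCases with
      | last => exact absurd hs (lt_irrefl _)
      | cast s =>
        rw [addStage_castSucc]
        exact h1 i hi s
    · rw [addStage_last] at hi ⊢
      exact h2 i hi
    · rw [addStage_last] at hn ⊢
      exact h3 hn
  | cast s =>
    rw [addStage_castSucc]
    obtain ⟨f1, f2, f3⟩ := hh s
    refine ⟨fun i hi s' hs' => ?_, f2, f3⟩
    induction s' using Fin.lastCases with
    | last => exact absurd hs' (Fin.castSucc_lt_last s).not_gt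
    | cast s' =>
      rw [addStage_castSucc]
      exact f1 i hi s' (Fin.castSucc_lt_castSucc_iff.1 hs')

/-- The record of a stage at which nobody bids. -/
def passRecord (x : unitInterval) : StageRecord := (x, fun _ => false, none)

/-- The record of a stage at which `i` is the only bidder. -/
def singleRecord (x : unitInterval) (i : Fin 2) : StageRecord := (x, fun k => decide (k = i), some i)

/-- The record of a stage at which both players bid and `i` gets the item. -/
def bothRecord (x : unitInterval) (i : Fin 2) : StageRecord := (x, fun _ => true, some i)

theorem feasible_passRecord (hh : Feasible h) (x : unitInterval) :
    Feasible (addStage h (passRecord x)) :=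
  feasible_addStage hh (by simp [passRecord, StageRecord.bids])
    (by simp [passRecord, StageRecord.taker]) (by simp [passRecord, StageRecord.bids])

theorem feasible_singleRecord (hh : Feasible h) (hi : Present h i) (x : unitInterval) :
    Feasible (addStage h (singleRecord x i)) :=
  feasible_addStage hh
    (fun k hk => by
      have : k = i := by simpa [singleRecord, StageRecord.bids] using hk
      exact this ▸ hi)
    (fun k hk => by
      have : i = k := by simpa [singleRecord, StageRecord.taker] using hk
      simp [singleRecord, StageRecord.bids, this])
    (by simp [singleRecord, StageRecord.taker])

theorem feasible_bothRecord (hh : Feasible h) (hp : ∀ k, Present h k) (x : unitInterval)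
    (i : Fin 2) : Feasible (addStage h (bothRecord x i)) :=
  feasible_addStage hh (fun k _ => hp k) (by simp [bothRecord, StageRecord.bids])
    (by simp [bothRecord, StageRecord.taker])

/-- The probability with which player `i` bids. -/
def bidding (σ : Profile) (h : History t) (x : unitInterval) (i : Fin 2) : ℝ :=
  bidProb σ h x i true

theorem bidding_of_present {σ : Profile} (hi : Present h i) (x : unitInterval) :
    bidding σ h x i = (σ i).bid t h x := by
  simp [bidding, bidProb, hi]

theorem bidding_of_not_present {σ : Profile} (hi : ¬ Present h i) (x : unitInterval) :
    bidding σ h x i = 0 := by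
  simp [bidding, bidProb, hi]

theorem bidding_mem_Icc (σ : Profile) (h : History t) (x : unitInterval) (i : Fin 2) :
    bidding σ h x i ∈ Set.Icc (0 : ℝ) 1 := by
  by_cases hi : Present h i
  · rw [bidding_of_present hi]
    exact Subtype.coe_prop _
  · rw [bidding_of_not_present hi]
    simp

theorem bidding_update_of_ne {σ : Profile} {τ : Strategy} (hij : j ≠ i) (h : History t)
    (x : unitInterval) : bidding (Function.update σ i τ) h x j = bidding σ h x j := by
  simp [bidding, bidProb, hij]

theorem bidProb_nonneg (σ : Profile) (h : History t) (x : unitInterval) (i : Fin 2) (b : Bool) :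
    0 ≤ bidProb σ h x i b := by
  have := bidding_mem_Icc σ h x i
  unfold bidding at this
  cases b
  · have e : bidProb σ h x i false = 1 - bidProb σ h x i true := by simp [bidProb]
    rw [e]
    linarith [this.2]
  · exact this.1

theorem allocProb_nonneg (b : Fin 2 → Bool) (w : Option (Fin 2)) : 0 ≤ allocProb b w := by
  cases w <;> simp only [allocProb] <;> split_ifs <;> positivity

/-- Allowing either order of the two players lets later arguments treat both at once, and makes the
exchange of players visible. -/
theorem stageExpectation_eq (σ : Profile) (h : History t) (x : unitInterval)
    (g : StageRecord → ℝ) (hij : i ≠ j) :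
    stageExpectation σ h x g =
      bidding σ h x i * bidding σ h x j * ((g (bothRecord x i) + g (bothRecord x j)) / 2) +
      bidding σ h x i * (1 - bidding σ h x j) * g (singleRecord x i) +
      (1 - bidding σ h x i) * bidding σ h x j * g (singleRecord x j) +
      (1 - bidding σ h x i) * (1 - bidding σ h x j) * g (passRecord x) := by
  have hf : ∀ i, bidProb σ h x i false = 1 - bidding σ h x i := fun i => by
    simp [bidding, bidProb]
  have ht : ∀ i, bidProb σ h x i true = bidding σ h x i := fun i => rfl
  have e1 : (fun _ => true : Fin 2 → Bool) = ![true, true] := by decide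
  have e2 : (fun k => decide (k = 0) : Fin 2 → Bool) = ![true, false] := by decide
  have e3 : (fun k => decide (k = 1) : Fin 2 → Bool) = ![false, true] := by decide
  have e4 : (fun _ => false : Fin 2 → Bool) = ![false, false] := by decide
  have base : stageExpectation σ h x g =
      bidding σ h x 0 * bidding σ h x 1 * ((g (bothRecord x 0) + g (bothRecord x 1)) / 2) +
      bidding σ h x 0 * (1 - bidding σ h x 1) * g (singleRecord x 0) +
      (1 - bidding σ h x 0) * bidding σ h x 1 * g (singleRecord x 1) +
      (1 - bidding σ h x 0) * (1 - bidding σ h x 1) * g (passRecord x) := by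
    unfold stageExpectation
    rw [← (finTwoArrowEquiv Bool).symm.sum_comp]
    simp only [bothRecord, singleRecord, passRecord, e1, e2, e3, e4]
    simp [Fintype.sum_prod_type, allocProb, hf, ht, Fin.forall_fin_two, Fin.sum_univ_two,
      -Finset.sum_boole]
    ring
  fin_cases i <;> fin_cases j
  · exact absurd rfl hij
  · exact base
  · rw [base]
    simp only [Fin.mk_one, Fin.zero_eta, Fin.isValue]
    ring
  · exact absurd rfl hij

theorem stageExpectation_mono {σ : Profile} {x : unitInterval} {g g' : StageRecord → ℝ}
    (hg : ∀ r, g r ≤ g' r) : stageExpectation σ h x g ≤ stageExpectation σ h x g' :=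
  Finset.sum_le_sum fun b _ => Finset.sum_le_sum fun w _ =>
    mul_le_mul_of_nonneg_left (hg _)
      (mul_nonneg (Finset.prod_nonneg fun i _ => bidProb_nonneg σ h x i _) (allocProb_nonneg b w))

theorem stageExpectation_const (σ : Profile) (h : History t) (x : unitInterval) (c : ℝ) :
    stageExpectation σ h x (fun _ => c) = c := by
  rw [stageExpectation_eq σ h x _ (zero_ne_one (α := Fin 2))]
  ring

end Basics

/-! ### Measurability and bounds of continuation payoffs -/

section Payoffs

variable {μ : Measure unitInterval} {σ σ' : Profile} {i j : Fin 2} {t m : ℕ}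

theorem measurable_addStage : Measurable fun p : History t × StageRecord => addStage p.1 p.2 := by
  refine measurable_pi_iff.2 fun s => ?_
  induction s using Fin.lastCases with
  | last => simpa using measurable_snd
  | cast s =>
    simp only [addStage_castSucc]
    exact (measurable_pi_apply s).comp measurable_fst

theorem measurable_taker : Measurable StageRecord.taker := measurable_snd.comp measurable_snd

theorem measurable_sample : Measurable StageRecord.sample := measurable_fst

theorem measurableSet_present (i : Fin 2) : MeasurableSet {h : History t | Present h i} := by
  have : {h : History t | Present h i} = ⋂ s, {h | (h s).taker ≠ some i} := by
    ext; simp [Present]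
  rw [this]
  refine MeasurableSet.iInter fun s => ?_
  have hm : Measurable fun h : History t => (h s).taker :=
    measurable_taker.comp (measurable_pi_apply s)
  exact hm (t := {w | w ≠ some i}) trivial

theorem measurable_bidding (σ : Profile) (i : Fin 2) :
    Measurable fun p : History t × unitInterval => bidding σ p.1 p.2 i := by
  classical
  have : (fun p : History t × unitInterval => bidding σ p.1 p.2 i) =
      fun p => if p ∈ Prod.fst ⁻¹' {h : History t | Present h i}
        then (((σ i).bid t p.1 p.2 : unitInterval) : ℝ) else 0 := by
    ext p
    simp only [bidding, bidProb, Set.mem_preimage, Set.mem_ofPred_eq, if_true]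
  rw [this]
  exact Measurable.ite (measurable_fst (measurableSet_present i))
    (measurable_subtype_coe.comp ((σ i).measurable_bid t)) measurable_const

theorem measurable_stageExpectation {g : History t × unitInterval → StageRecord → ℝ}
    (hg : Measurable fun p : (History t × unitInterval) × StageRecord => g p.1 p.2) :
    Measurable fun p : History t × unitInterval => stageExpectation σ p.1 p.2 (g p) := by
  have hrec : ∀ b w, Measurable fun p : History t × unitInterval => g p (p.2, b, w) := fun b w =>
    hg.comp (measurable_id.prodMk (measurable_snd.prodMk measurable_const))
  have h0 := measurable_bidding (t := t) σ 0
  have h1 := measurable_bidding (t := t) σ 1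
  simp only [stageExpectation_eq _ _ _ _ (zero_ne_one (α := Fin 2))]
  exact ((((h0.mul h1).mul (((hrec _ _).add (hrec _ _)).div_const 2)).add
    ((h0.mul (h1.const_sub 1)).mul (hrec _ _))).add
    (((h0.const_sub 1).mul h1).mul (hrec _ _))).add
    (((h0.const_sub 1).mul (h1.const_sub 1)).mul (hrec _ _))

theorem measurable_receipts (i : Fin 2) : Measurable fun h : History t => receipts h i := by
  refine Finset.measurable_sum _ fun s _ => ?_
  have hm : Measurable fun h : History t => (h s).taker :=
    measurable_taker.comp (measurable_pi_apply s)
  exact Measurable.ite (hm (t := {w | w = some i}) trivial)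
    (measurable_subtype_coe.comp (measurable_sample.comp (measurable_pi_apply s))) measurable_const

variable [IsProbabilityMeasure μ]

omit [IsProbabilityMeasure μ] in
theorem measurable_contPayoffAt_of (hm : Measurable fun h : History (t + 1) => contPayoff μ σ i m h) :
    Measurable fun p : History t × unitInterval => contPayoffAt μ σ i m p.1 p.2 := by
  have h1 : Measurable fun p : (History t × unitInterval) × StageRecord => addStage p.1.1 p.2 :=
    measurable_addStage.comp ((measurable_fst.comp measurable_fst).prodMk measurable_snd)
  exact measurable_stageExpectation (g := fun p r => contPayoff μ σ i m (addStage p.1 r))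
    (hm.comp h1)

theorem measurable_contPayoff (μ : Measure unitInterval) [IsProbabilityMeasure μ] (σ : Profile)
    (i : Fin 2) (m t : ℕ) : Measurable fun h : History t => contPayoff μ σ i m h := by
  induction m generalizing t with
  | zero => exact measurable_receipts i
  | succ m ih =>
    exact (measurable_contPayoffAt_of (ih (t + 1))).stronglyMeasurable.integral_prod_right'.measurable

theorem measurable_contPayoffAt (h : History t) :
    Measurable fun x => contPayoffAt μ σ i m h x := by
  have key : ∀ F : History t × unitInterval → ℝ, Measurable F → Measurable fun x => F (h, x) :=
    fun F hF => hF.comp measurable_prodMk_left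
  exact key (fun p => contPayoffAt μ σ i m p.1 p.2)
    (measurable_contPayoffAt_of (measurable_contPayoff μ σ i m (t + 1)))

omit [IsProbabilityMeasure μ] in
theorem contPayoff_succ (h : History t) :
    contPayoff μ σ i (m + 1) h = ∫ x, contPayoffAt μ σ i m h x ∂μ := rfl

/-- Each past or future stage contributes at most 1. The crude bound also covers infeasible
histories, where a player may have several items; it serves integrability. -/
theorem contPayoff_mem_Icc (μ : Measure unitInterval) [IsProbabilityMeasure μ] (σ : Profile)
    (i : Fin 2) (m : ℕ) : ∀ {t : ℕ} (h : History t),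
      contPayoff μ σ i m h ∈ Set.Icc (0 : ℝ) (t + m) := by
  induction m with
  | zero => exact fun h => ⟨receipts_nonneg, by simpa [contPayoff] using receipts_le (h := h) (i := i)⟩
  | succ m ih =>
    intro t h
    have hb : ∀ x, contPayoffAt μ σ i m h x ∈ Set.Icc (0 : ℝ) (t + ((m + 1 : ℕ) : ℝ)) := by
      intro x
      constructor
      · exact (stageExpectation_const σ h x 0).symm.le.trans
          (stageExpectation_mono fun r => (ih _).1)
      · refine (stageExpectation_mono fun r => ?_).trans (stageExpectation_const σ h x _).le
        have := (ih (addStage h r)).2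
        push_cast at this ⊢
        linarith
    rw [contPayoff_succ]
    have hi : Integrable (fun x => contPayoffAt μ σ i m h x) μ :=
      integrable_of_abs_le (measurable_contPayoffAt h) (t + ((m + 1 : ℕ) : ℝ)) fun x =>
        abs_le.2 ⟨by linarith [(hb x).1, (hb x).2], (hb x).2⟩
    refine ⟨integral_nonneg fun x => (hb x).1, ?_⟩
    simpa using integral_mono hi (integrable_const _) fun x => (hb x).2

theorem integrable_contPayoffAt (h : History t) :
    Integrable (fun x => contPayoffAt μ σ i m h x) μ := by
  refine integrable_of_abs_le (measurable_contPayoffAt h) (t + 1 + m) fun x => ?_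
  have h1 : 0 ≤ contPayoffAt μ σ i m h x := (stageExpectation_const σ h x 0).symm.le.trans
    (stageExpectation_mono fun r => (contPayoff_mem_Icc μ σ i m _).1)
  have h2 : contPayoffAt μ σ i m h x ≤ t + 1 + m := by
    refine (stageExpectation_mono fun r => ?_).trans (stageExpectation_const σ h x _).le
    simpa using (contPayoff_mem_Icc μ σ i m (addStage h r)).2
  exact abs_le.2 ⟨by linarith, h2⟩

omit [IsProbabilityMeasure μ] in
theorem stageExpectation_congr {h : History t} {x : unitInterval} {g g' : StageRecord → ℝ}
    (hb : ∀ i, (σ i).bid t h x = (σ' i).bid t h x) (hg : ∀ r, g r = g' r) :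
    stageExpectation σ h x g = stageExpectation σ' h x g' := by
  unfold stageExpectation bidProb
  simp only [hb, hg]

omit [IsProbabilityMeasure μ] in
theorem contPayoff_congr (i : Fin 2) (m : ℕ) : ∀ {t : ℕ} (h : History t),
    (∀ i s, t ≤ s → (σ i).bid s = (σ' i).bid s) →
      contPayoff μ σ i m h = contPayoff μ σ' i m h := by
  induction m with
  | zero => exact fun h _ => rfl
  | succ m ih =>
    intro t h hσ
    refine integral_congr_ae (Filter.Eventually.of_forall fun x => ?_)
    refine stageExpectation_congr (fun i => by rw [hσ i t le_rfl]) fun r => ?_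
    exact ih _ fun i s hs => hσ i s (by omega)

theorem stageExpectation_of_not_present {h : History t} (hij : i ≠ j) (hi : ¬ Present h i)
    (x : unitInterval) (g : StageRecord → ℝ) :
    stageExpectation σ h x g =
      bidding σ h x j * g (singleRecord x j) + (1 - bidding σ h x j) * g (passRecord x) := by
  rw [stageExpectation_eq σ h x g hij, bidding_of_not_present hi]
  ring

/-- A player who has left bids with probability 0, so no record of positive probability names him as
taker again. -/
theorem contPayoff_of_not_present (i : Fin 2) (m : ℕ) : ∀ {t : ℕ} (h : History t),
    ¬ Present h i → contPayoff μ σ i m h = receipts h i := by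
  induction m with
  | zero => exact fun h _ => rfl
  | succ m ih =>
    intro t h hi
    obtain ⟨j, hij⟩ : ∃ j, i ≠ j := ⟨1 - i, by fin_cases i <;> decide⟩
    have hx : ∀ x, contPayoffAt μ σ i m h x = receipts h i := by
      intro x
      unfold contPayoffAt
      have hn : ∀ r, ¬ Present (addStage h r) i := fun r hr => hi (present_addStage.1 hr).1
      rw [stageExpectation_of_not_present hij hi, ih _ (hn _), ih _ (hn _), receipts_addStage,
        receipts_addStage]
      simp [singleRecord, passRecord, StageRecord.taker, hij.symm]
      ring
    rw [contPayoff_succ]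
    simp [hx]

theorem contPayoff_of_takes {h : History t} {r : StageRecord} (hi : Present h i)
    (hr : r.taker = some i) : contPayoff μ σ i m (addStage h r) = r.sample := by
  rw [contPayoff_of_not_present i m _ fun hp => (present_addStage.1 hp).2 hr, receipts_addStage,
    receipts_of_present hi, if_pos hr, zero_add]

/-- The payoff of a bidder who bids with probability `q` for an item of value `x` while the other
player bids with probability `r`; `c` is the value of continuing alone and `a` that of continuing
together with the other player. -/
def stagePayoff (x c a q r : ℝ) : ℝ :=
  q * r * ((x + c) / 2) + q * (1 - r) * x + (1 - q) * r * c + (1 - q) * (1 - r) * a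

theorem stageExpectation_solo {h : History t} (hij : i ≠ j) (hi : Present h i)
    (hj : ¬ Present h j) (x : unitInterval) :
    stageExpectation σ h x (fun r => contPayoff μ σ' i m (addStage h r)) =
      bidding σ h x i * x +
        (1 - bidding σ h x i) * contPayoff μ σ' i m (addStage h (passRecord x)) := by
  rw [stageExpectation_of_not_present hij.symm hj, contPayoff_of_takes hi rfl]
  rfl

theorem stageExpectation_both {h : History t} (hij : i ≠ j) (hi : Present h i)
    (x : unitInterval) {c : ℝ}
    (hb : contPayoff μ σ' i m (addStage h (bothRecord x j)) = c)
    (hs : contPayoff μ σ' i m (addStage h (singleRecord x j)) = c) :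
    stageExpectation σ h x (fun r => contPayoff μ σ' i m (addStage h r)) =
      stagePayoff x c (contPayoff μ σ' i m (addStage h (passRecord x)))
        (bidding σ h x i) (bidding σ h x j) := by
  rw [stageExpectation_eq σ h x _ hij, hb, hs, contPayoff_of_takes hi rfl,
    contPayoff_of_takes hi rfl]
  rfl

end Payoffs

/-! ### The one-shot deviation principle -/

section OneShot

variable {μ : Measure unitInterval} [IsProbabilityMeasure μ] {σ : Profile} {i j : Fin 2}
  {n t m : ℕ}

/-- The strategy `τ`, changed at stage `t` to bidding with probability `p`. -/
def Strategy.deviate (τ : Strategy) (t : ℕ) (p : unitInterval) : Strategy where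
  bid s h x := if s = t then p else τ.bid s h x
  measurable_bid s := by
    by_cases hs : s = t
    · simp only [hs, if_true]
      exact measurable_const
    · simp only [hs, if_false]
      exact τ.measurable_bid s

-- The deviation is constant at stage `t`, hence measurable, and leaves later stages unchanged.
-- Since equilibrium is also required after the sample is observed, the inequality holds for every
-- `x` and not just almost every one.
omit [IsProbabilityMeasure μ] in
theorem IsSPE.oneShot (hσ : IsSPE μ n σ) (hn : t + 1 + m = n) {h : History t} (hh : Feasible h)
    (hi : Present h i) (x : unitInterval) {p : ℝ} (hp : p ∈ Set.Icc (0 : ℝ) 1) :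
    ∃ σ' : Profile, bidding σ' h x i = p ∧ (∀ j, j ≠ i → bidding σ' h x j = bidding σ h x j) ∧
      stageExpectation σ' h x (fun r => contPayoff μ σ i m (addStage h r)) ≤
        contPayoffAt μ σ i m h x := by
  refine ⟨Function.update σ i ((σ i).deviate t ⟨p, hp⟩), ?_, fun j hj => bidding_update_of_ne hj h x,
    ?_⟩
  · rw [bidding_of_present hi]
    simp [Strategy.deviate]
  · refine le_trans (le_of_eq ?_) (hσ.2 t m hn h hh x i ((σ i).deviate t ⟨p, hp⟩))
    refine stageExpectation_congr (fun _ => rfl) fun r => contPayoff_congr i m _ fun k s hs => ?_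
    by_cases hk : k = i
    · subst hk
      have : s ≠ t := by omega
      ext
      simp [Strategy.deviate, this]
    · simp [hk]

/-- Backward induction: by the induction hypothesis a deviator does not lose by returning to `σ`
after the current stage, and a deviation at this stage alone does not pay by `H`. -/
theorem isSPE_of_oneShot (H : ∀ t m : ℕ, t + 1 + m = n → ∀ (h : History t) (x : unitInterval)
    (i : Fin 2) (τ : Strategy), stageExpectation (Function.update σ i τ) h x
      (fun r => contPayoff μ σ i m (addStage h r)) ≤ contPayoffAt μ σ i m h x) : IsSPE μ n σ := by
  have hstep : ∀ (i : Fin 2) (τ : Strategy) (t m : ℕ), t + 1 + m = n →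
      (∀ h : History (t + 1), contPayoff μ (Function.update σ i τ) i m h ≤ contPayoff μ σ i m h) →
      ∀ (h : History t) (x : unitInterval),
        contPayoffAt μ (Function.update σ i τ) i m h x ≤ contPayoffAt μ σ i m h x :=
    fun i τ t m hn ih h x => (stageExpectation_mono fun r => ih _).trans (H t m hn h x i τ)
  have hall : ∀ (i : Fin 2) (τ : Strategy) (m t : ℕ), t + m = n → ∀ h : History t,
      contPayoff μ (Function.update σ i τ) i m h ≤ contPayoff μ σ i m h := by
    intro i τ m
    induction m with
    | zero => exact fun t _ h => le_rfl
    | succ m ih =>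
      intro t hn h
      rw [contPayoff_succ, contPayoff_succ]
      exact integral_mono (integrable_contPayoffAt h) (integrable_contPayoffAt h)
        (hstep i τ t m (by omega) (ih (t + 1) (by omega)) h)
  exact ⟨fun t m hn h _ i τ => hall i τ m t hn h,
    fun t m hn h _ x i τ => hstep i τ t m hn (hall i τ m (t + 1) hn) h x⟩

end OneShot

/-! ### The recursive description of equilibrium payoffs -/

section Recursion

/-- The value of the optimal stopping problem of a single player with `m` samples to arrive. -/
def soloValue (μ : Measure unitInterval) : ℕ → ℝ
  | 0 => 0
  | m + 1 => ∫ x, max (x : ℝ) (soloValue μ m) ∂μ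

/-- The coordinates of a pair, indexed by the players. -/
def coord (z : ℝ × ℝ) (i : Fin 2) : ℝ := if i = 0 then z.1 else z.2

/-- `q` is an equilibrium in bidding probabilities for an item of value `x` if `c` is the value of
continuing alone and `v` are the values of continuing together. -/
def IsStageEq (x c : ℝ) (v q : ℝ × ℝ) : Prop :=
  q ∈ Set.Icc (0 : ℝ × ℝ) 1 ∧ ∀ p ∈ Set.Icc (0 : ℝ) 1,
    stagePayoff x c v.1 p q.2 ≤ stagePayoff x c v.1 q.1 q.2 ∧
    stagePayoff x c v.2 p q.1 ≤ stagePayoff x c v.2 q.2 q.1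

/-- The payoffs of the two players in the situation of `IsStageEq`. -/
def stageValue (x c : ℝ) (v q : ℝ × ℝ) : ℝ × ℝ :=
  (stagePayoff x c v.1 q.1 q.2, stagePayoff x c v.2 q.2 q.1)

/-- The graph of the correspondence assigning to a sample the equilibrium payoffs of the stage game
with continuation values in `E`. -/
def eqGraph (c : ℝ) (E : Set (ℝ × ℝ)) : Set (unitInterval × (ℝ × ℝ)) :=
  {p | ∃ v ∈ E, ∃ q, IsStageEq p.1 c v q ∧ p.2 = stageValue p.1 c v q}

/-- The equilibrium payoffs with `m` samples to arrive, defined by backward recursion. -/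
def eqValues (μ : Measure unitInterval) : ℕ → Set (ℝ × ℝ)
  | 0 => {0}
  | m + 1 => integralSet μ (eqGraph (soloValue μ m) (eqValues μ m))

variable {x c : ℝ} {v q : ℝ × ℝ} {i j : Fin 2}

theorem ne_iff_fin_two : i ≠ j ↔ i = 0 ∧ j = 1 ∨ i = 1 ∧ j = 0 := by
  fin_cases i <;> fin_cases j <;> decide

theorem IsStageEq.coord_le (hq : IsStageEq x c v q) (hij : i ≠ j) {p : ℝ}
    (hp : p ∈ Set.Icc (0 : ℝ) 1) : stagePayoff x c (coord v i) p (coord q j) ≤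
      stagePayoff x c (coord v i) (coord q i) (coord q j) := by
  rcases ne_iff_fin_two.1 hij with ⟨rfl, rfl⟩ | ⟨rfl, rfl⟩
  exacts [(hq.2 p hp).1, (hq.2 p hp).2]

theorem coord_stageValue (hij : i ≠ j) : coord (stageValue x c v q) i =
    stagePayoff x c (coord v i) (coord q i) (coord q j) := by
  rcases ne_iff_fin_two.1 hij with ⟨rfl, rfl⟩ | ⟨rfl, rfl⟩ <;> rfl

/-- If `x ≥ c`, both bid. Otherwise a player whose continuation value is at most `x` bids alone, the
other preferring `c`; if there is no such player, both pass. -/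
theorem exists_isStageEq (x c : ℝ) (v : ℝ × ℝ) : ∃ q, IsStageEq x c v q := by
  simp only [IsStageEq, stagePayoff]
  rcases le_total c x with hx | hx
  · refine ⟨(1, 1), ⟨by simp [Prod.le_def], by simp [Prod.le_def]⟩, fun p hp => ?_⟩
    constructor <;> nlinarith [mul_nonneg (sub_nonneg.2 hp.2) (sub_nonneg.2 hx)]
  · rcases le_total v.1 x with h1 | h1
    · refine ⟨(1, 0), ⟨by simp [Prod.le_def], by simp [Prod.le_def]⟩, fun p hp => ?_⟩
      constructor
      · nlinarith [mul_nonneg (sub_nonneg.2 hp.2) (sub_nonneg.2 h1)]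
      · nlinarith [mul_nonneg hp.1 (sub_nonneg.2 hx)]
    · rcases le_total v.2 x with h2 | h2
      · refine ⟨(0, 1), ⟨by simp [Prod.le_def], by simp [Prod.le_def]⟩, fun p hp => ?_⟩
        constructor
        · nlinarith [mul_nonneg hp.1 (sub_nonneg.2 hx)]
        · nlinarith [mul_nonneg (sub_nonneg.2 hp.2) (sub_nonneg.2 h2)]
      · refine ⟨(0, 0), ⟨by simp [Prod.le_def], by simp [Prod.le_def]⟩, fun p hp => ?_⟩
        constructor
        · nlinarith [mul_nonneg hp.1 (sub_nonneg.2 h1)]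
        · nlinarith [mul_nonneg hp.1 (sub_nonneg.2 h2)]

theorem stagePayoff_mem_Icc {x c a q r : ℝ} (hx : x ∈ Set.Icc (0 : ℝ) 1)
    (hc : c ∈ Set.Icc (0 : ℝ) 1) (ha : a ∈ Set.Icc (0 : ℝ) 1) (hq : q ∈ Set.Icc (0 : ℝ) 1)
    (hr : r ∈ Set.Icc (0 : ℝ) 1) : stagePayoff x c a q r ∈ Set.Icc (0 : ℝ) 1 := by
  have w1 := mul_nonneg hq.1 hr.1
  have w2 := mul_nonneg hq.1 (sub_nonneg.2 hr.2)
  have w3 := mul_nonneg (sub_nonneg.2 hq.2) hr.1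
  have w4 := mul_nonneg (sub_nonneg.2 hq.2) (sub_nonneg.2 hr.2)
  unfold stagePayoff
  have hm : (x + c) / 2 ∈ Set.Icc (0 : ℝ) 1 := ⟨by linarith [hx.1, hc.1], by linarith [hx.2, hc.2]⟩
  constructor
  · have := mul_nonneg w1 hm.1
    have := mul_nonneg w2 hx.1
    have := mul_nonneg w3 hc.1
    have := mul_nonneg w4 ha.1
    linarith
  · have h1 := mul_le_mul_of_nonneg_left hm.2 w1
    have h2 := mul_le_mul_of_nonneg_left hx.2 w2
    have h3 := mul_le_mul_of_nonneg_left hc.2 w3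
    have h4 := mul_le_mul_of_nonneg_left ha.2 w4
    nlinarith

end Recursion

/-! ### Equilibrium payoffs satisfy the recursion -/

section Necessity

variable {μ : Measure unitInterval} [IsProbabilityMeasure μ] {σ : Profile} {i j : Fin 2}
  {n : ℕ}

theorem soloValue_mem_Icc (μ : Measure unitInterval) [IsProbabilityMeasure μ] (m : ℕ) :
    soloValue μ m ∈ Set.Icc (0 : ℝ) 1 := by
  induction m with
  | zero => simp [soloValue]
  | succ m ih =>
    have hb : ∀ x : unitInterval, max (x : ℝ) (soloValue μ m) ∈ Set.Icc (0 : ℝ) 1 := fun x =>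
      ⟨x.2.1.trans (le_max_left _ _), max_le x.2.2 ih.2⟩
    have hi : Integrable (fun x : unitInterval => max (x : ℝ) (soloValue μ m)) μ :=
      integrable_of_abs_le (measurable_subtype_coe.max measurable_const) 1 fun x =>
        abs_le.2 ⟨by linarith [(hb x).1], (hb x).2⟩
    refine ⟨integral_nonneg fun x => (hb x).1, ?_⟩
    simpa [soloValue] using integral_mono hi (integrable_const 1) fun x => (hb x).2

theorem present_passRecord {t : ℕ} {h : History t} (x : unitInterval) :
    Present (addStage h (passRecord x)) i ↔ Present h i := by
  simp [present_addStage, passRecord, StageRecord.taker]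

theorem present_singleRecord {t : ℕ} {h : History t} (x : unitInterval) :
    Present (addStage h (singleRecord x j)) i ↔ Present h i ∧ i ≠ j := by
  simp [present_addStage, singleRecord, StageRecord.taker, eq_comm]

theorem present_bothRecord {t : ℕ} {h : History t} (x : unitInterval) :
    Present (addStage h (bothRecord x j)) i ↔ Present h i ∧ i ≠ j := by
  simp [present_addStage, bothRecord, StageRecord.taker, eq_comm]

/-- In equilibrium a player who is alone gets the value of his optimal stopping problem. -/
theorem IsSPE.contPayoff_solo (hσ : IsSPE μ n σ) (hij : i ≠ j) (m : ℕ) :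
    ∀ t, t + m = n → ∀ h : History t, Feasible h → Present h i → ¬ Present h j →
      contPayoff μ σ i m h = soloValue μ m := by
  induction m with
  | zero => exact fun t _ h _ hi _ => receipts_of_present hi
  | succ m ih =>
    intro t hn h hh hi hj
    refine integral_congr_ae (Filter.Eventually.of_forall fun x => ?_)
    have hpass : contPayoff μ σ i m (addStage h (passRecord x)) = soloValue μ m :=
      ih (t + 1) (by omega) _ (feasible_passRecord hh x) ((present_passRecord x).2 hi)
        (mt (present_passRecord x).1 hj)
    have hval : contPayoffAt μ σ i m h x = bidding σ h x i * x +
        (1 - bidding σ h x i) * soloValue μ m := by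
      rw [contPayoffAt, stageExpectation_solo hij hi hj, hpass]
    have hq := bidding_mem_Icc σ h x i
    refine le_antisymm ?_ (max_le ?_ ?_)
    · change contPayoffAt μ σ i m h x ≤ _
      rw [hval]
      nlinarith [mul_le_mul_of_nonneg_left (le_max_left (x : ℝ) (soloValue μ m)) hq.1,
        mul_le_mul_of_nonneg_left (le_max_right (x : ℝ) (soloValue μ m)) (sub_nonneg.2 hq.2)]
    · obtain ⟨σ', h1, -, h3⟩ := hσ.oneShot (m := m) (by omega) hh hi x
        (Set.right_mem_Icc.2 zero_le_one)
      rw [stageExpectation_solo hij hi hj, h1] at h3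
      exact le_trans (by simp) h3
    · obtain ⟨σ', h1, -, h3⟩ := hσ.oneShot (m := m) (by omega) hh hi x
        (Set.left_mem_Icc.2 zero_le_one)
      rw [stageExpectation_solo hij hi hj, h1, hpass] at h3
      exact le_trans (by simp) h3

/-- If the opponent gets the item, contested or not, player `i` is alone and worth `soloValue`; so
the stage reduces to `stagePayoff`, whatever profile is used at this stage. -/
theorem IsSPE.stageExpectation_both (hσ : IsSPE μ n σ) {t m : ℕ} (hn : t + 1 + m = n)
    {h : History t} (hh : Feasible h) (hp : ∀ k, Present h k) (hij : i ≠ j) (x : unitInterval)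
    (σ' : Profile) :
    stageExpectation σ' h x (fun r => contPayoff μ σ i m (addStage h r)) =
      stagePayoff x (soloValue μ m) (contPayoff μ σ i m (addStage h (passRecord x)))
        (bidding σ' h x i) (bidding σ' h x j) :=
  NoRecallGame.stageExpectation_both hij (hp i) x
    (hσ.contPayoff_solo hij m _ hn _ (feasible_bothRecord hh hp x j)
      ((present_bothRecord x).2 ⟨hp i, hij⟩) fun h => ((present_bothRecord x).1 h).2 rfl)
    (hσ.contPayoff_solo hij m _ hn _ (feasible_singleRecord hh (hp j) x)
      ((present_singleRecord x).2 ⟨hp i, hij⟩) fun h => ((present_singleRecord x).1 h).2 rfl)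

/-- The payoffs after observing `x` form the required measurable selection: the bids are a stage
equilibrium by one-shot deviations, and the continuation values after a joint pass lie in the
previous set by induction. -/
theorem IsSPE.mem_eqValues (hσ : IsSPE μ n σ) (m : ℕ) :
    ∀ t, t + m = n → ∀ h : History t, Feasible h → (∀ k, Present h k) →
      (contPayoff μ σ 0 m h, contPayoff μ σ 1 m h) ∈ eqValues μ m := by
  induction m with
  | zero =>
    intro t _ h _ hp
    simp [contPayoff, receipts_of_present (hp _), eqValues]
  | succ m ih =>
    intro t hn h hh hp
    have hn' : t + 1 + m = n := by omega
    refine ⟨fun x => (contPayoffAt μ σ 0 m h x, contPayoffAt μ σ 1 m h x),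
      (measurable_contPayoffAt h).prodMk (measurable_contPayoffAt h), fun x => ?_, rfl⟩
    have h01 : (0 : Fin 2) ≠ 1 := zero_ne_one
    have h10 : (1 : Fin 2) ≠ 0 := one_ne_zero
    have hat : ∀ i j : Fin 2, i ≠ j → contPayoffAt μ σ i m h x =
        stagePayoff x (soloValue μ m) (contPayoff μ σ i m (addStage h (passRecord x)))
          (bidding σ h x i) (bidding σ h x j) := fun i j hij =>
      hσ.stageExpectation_both hn' hh hp hij x σ
    have hdev : ∀ i j : Fin 2, i ≠ j → ∀ p ∈ Set.Icc (0 : ℝ) 1,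
        stagePayoff x (soloValue μ m) (contPayoff μ σ i m (addStage h (passRecord x)))
          p (bidding σ h x j) ≤ contPayoffAt μ σ i m h x := by
      intro i j hij p hpI
      obtain ⟨σ', h1, h2, h3⟩ := hσ.oneShot (m := m) hn' hh (hp i) x hpI
      rwa [hσ.stageExpectation_both hn' hh hp hij x σ', h1, h2 j hij.symm] at h3
    refine ⟨_, ih (t + 1) hn' _ (feasible_passRecord hh x) fun k => (present_passRecord x).2 (hp k),
      (bidding σ h x 0, bidding σ h x 1), ⟨⟨⟨(bidding_mem_Icc σ h x 0).1, (bidding_mem_Icc σ h x 1).1⟩,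
        (bidding_mem_Icc σ h x 0).2, (bidding_mem_Icc σ h x 1).2⟩, fun p hpI => ⟨?_, ?_⟩⟩, ?_⟩
    · exact (hdev 0 1 h01 p hpI).trans_eq (hat 0 1 h01)
    · exact (hdev 1 0 h10 p hpI).trans_eq (hat 1 0 h10)
    · exact Prod.ext (hat 0 1 h01) (hat 1 0 h10)

end Necessity

/-! ### Structure of the recursively defined sets for atomless laws -/

section Structure

variable {μ : Measure unitInterval} [IsProbabilityMeasure μ]

/-- The equilibria of the stage games with continuation values in `E`, together with their
payoffs. -/
def eqGraphFull (c : ℝ) (E : Set (ℝ × ℝ)) :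
    Set ((unitInterval × (ℝ × ℝ)) × ((ℝ × ℝ) × (ℝ × ℝ))) :=
  {p | p.2.1 ∈ E ∧ IsStageEq p.1.1 c p.2.1 p.2.2 ∧ p.1.2 = stageValue p.1.1 c p.2.1 p.2.2}

theorem isClosed_eqGraphFull (c : ℝ) {E : Set (ℝ × ℝ)} (hE : IsClosed E) :
    IsClosed (eqGraphFull c E) := by
  have hsub : eqGraphFull c E =
      ({p | p.2.1 ∈ E} ∩ ({p | p.2.2 ∈ Set.Icc (0 : ℝ × ℝ) 1} ∩
        ⋂ s ∈ Set.Icc (0 : ℝ) 1,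
          ({p | stagePayoff p.1.1 c p.2.1.1 s p.2.2.2 ≤
            stagePayoff p.1.1 c p.2.1.1 p.2.2.1 p.2.2.2} ∩
          {p | stagePayoff p.1.1 c p.2.1.2 s p.2.2.1 ≤
            stagePayoff p.1.1 c p.2.1.2 p.2.2.2 p.2.2.1}))) ∩
      {p | p.1.2 = stageValue p.1.1 c p.2.1 p.2.2} := by
    ext p
    simp only [eqGraphFull, IsStageEq, Set.mem_ofPred_eq, Set.mem_inter_iff, Set.mem_iInter]
    tauto
  rw [hsub]
  refine ((hE.preimage (by fun_prop)).inter ((isClosed_Icc.preimage (by fun_prop)).inter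
    (isClosed_biInter fun s _ => (isClosed_le ?_ ?_).inter (isClosed_le ?_ ?_)))).inter
    (isClosed_eq ?_ ?_)
  all_goals
    try simp only [stageValue, stagePayoff]
    fun_prop

theorem stageValue_mem_box {c : ℝ} (hc : c ∈ Set.Icc (0 : ℝ) 1) (x : unitInterval) {v q : ℝ × ℝ}
    (hv : v ∈ Set.Icc (0 : ℝ × ℝ) 1) (hq : q ∈ Set.Icc (0 : ℝ × ℝ) 1) :
    stageValue x c v q ∈ Set.Icc (0 : ℝ × ℝ) 1 := by
  have h1 := stagePayoff_mem_Icc x.2 hc ⟨hv.1.1, hv.2.1⟩ ⟨hq.1.1, hq.2.1⟩ ⟨hq.1.2, hq.2.2⟩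
  have h2 := stagePayoff_mem_Icc x.2 hc ⟨hv.1.2, hv.2.2⟩ ⟨hq.1.2, hq.2.2⟩ ⟨hq.1.1, hq.2.1⟩
  exact ⟨⟨h1.1, h2.1⟩, h1.2, h2.2⟩

theorem eqGraph_box {c : ℝ} (hc : c ∈ Set.Icc (0 : ℝ) 1) {E : Set (ℝ × ℝ)}
    (hE : E ⊆ Set.Icc 0 1) : ∀ p ∈ eqGraph c E, p.2 ∈ Set.Icc (0 : ℝ × ℝ) 1 := by
  rintro ⟨x, w⟩ ⟨v, hv, q, hq, hw⟩
  exact hw ▸ stageValue_mem_box hc x (hE hv) hq.1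

/-- The graph is the projection of the compact set of equilibria together with their continuation
values and payoffs. -/
theorem isClosed_eqGraph {c : ℝ} (hc : c ∈ Set.Icc (0 : ℝ) 1) {E : Set (ℝ × ℝ)}
    (hE : IsCompact E) (hE' : E ⊆ Set.Icc 0 1) : IsClosed (eqGraph c E) := by
  have himg : eqGraph c E = Prod.fst '' eqGraphFull c E := by
    ext ⟨x, w⟩
    constructor
    · rintro ⟨v, hv, q, hq, hw⟩
      exact ⟨((x, w), (v, q)), ⟨hv, hq, hw⟩, rfl⟩
    · rintro ⟨⟨⟨x', w'⟩, v, q⟩, ⟨hv, hq, hw⟩, h⟩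
      obtain ⟨rfl, rfl⟩ := Prod.mk.inj h
      exact ⟨v, hv, q, hq, hw⟩
  have hcpt : IsCompact (eqGraphFull c E) := by
    refine IsCompact.of_isClosed_subset
      (((isCompact_univ (X := unitInterval)).prod isCompact_box).prod (hE.prod isCompact_box))
      (isClosed_eqGraphFull c hE.isClosed) ?_
    rintro ⟨⟨x, w⟩, v, q⟩ ⟨hv, hq, hw⟩
    exact ⟨⟨trivial, eqGraph_box hc hE' (x, w) ⟨v, hv, q, hq, hw⟩⟩, hv, hq.1⟩
  rw [himg]
  exact (hcpt.image continuous_fst).isClosed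

theorem eqGraph_nonempty (c : ℝ) {E : Set (ℝ × ℝ)} (hE : E.Nonempty) (x : unitInterval) :
    ∃ z, (x, z) ∈ eqGraph c E := by
  obtain ⟨v, hv⟩ := hE
  obtain ⟨q, hq⟩ := exists_isStageEq x c v
  exact ⟨stageValue x c v q, v, hv, q, hq, rfl⟩

theorem eqValues_spec (μ : Measure unitInterval) [IsProbabilityMeasure μ] [NullSingletonClass μ]
    (m : ℕ) : IsCompact (eqValues μ m) ∧ Convex ℝ (eqValues μ m) ∧ (eqValues μ m).Nonempty ∧
      eqValues μ m ⊆ Set.Icc 0 1 := by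
  induction m with
  | zero =>
    refine ⟨isCompact_singleton, convex_singleton _, Set.singleton_nonempty _, ?_⟩
    exact Set.singleton_subset_iff.2 (Set.left_mem_Icc.2 zero_le_one)
  | succ m ih =>
    have hc := soloValue_mem_Icc μ m
    obtain ⟨h1, h2, h3, h4, -⟩ := integralSet_spec (μ := μ) (isClosed_eqGraph hc ih.1 ih.2.2.2)
      (eqGraph_box hc ih.2.2.2) (eqGraph_nonempty _ ih.2.2.1)
    exact ⟨h1, h2, h3, h4⟩

/-- Measurable continuation values and bidding probabilities that implement given equilibrium
payoffs. -/
theorem exists_implementation (μ : Measure unitInterval) [IsProbabilityMeasure μ]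
    [NullSingletonClass μ] (m : ℕ) : ∃ V Q : (ℝ × ℝ) × unitInterval → ℝ × ℝ,
      Measurable V ∧ Measurable Q ∧ (∀ p, V p ∈ eqValues μ m) ∧
      (∀ p, IsStageEq p.2 (soloValue μ m) (V p) (Q p)) ∧
      ∀ y ∈ eqValues μ (m + 1),
        vint μ (fun x => stageValue x (soloValue μ m) (V (y, x)) (Q (y, x))) = y := by
  obtain ⟨hE, -, hEne, hEbox⟩ := eqValues_spec μ m
  have hc := soloValue_mem_Icc μ m
  obtain ⟨-, -, -, -, W, hWm, hWG, hWv⟩ := integralSet_spec (μ := μ)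
    (isClosed_eqGraph hc hE hEbox) (eqGraph_box hc hEbox) (eqGraph_nonempty _ hEne)
  set F := eqGraphFull (soloValue μ m) (eqValues μ m) with hF
  have hFcl : IsClosed F := isClosed_eqGraphFull _ hE.isClosed
  have hex : ∀ p : (ℝ × ℝ) × unitInterval, ∃ z, ((p.2, W p.1 p.2), z) ∈ F := by
    intro p
    obtain ⟨v, hv, q, hq, hw⟩ := hWG p.1 p.2
    exact ⟨(v, q), hv, hq, hw⟩
  have hFne : F.Nonempty := ⟨_, (hex (0, 0)).choose_spec⟩
  -- Given the stage payoffs `W`, a continuation value and a bid pair realizing them are selected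
  -- measurably, as a zero of the distance to the closed set `F`.
  obtain ⟨s, hs, hsF⟩ := exists_measurable_zero (hE.prod isCompact_box)
    (Φ := fun (p : (ℝ × ℝ) × unitInterval) z => Metric.infDist ((p.2, W p.1 p.2), z) F)
    (fun z => (Metric.continuous_infDist_pt F).measurable.comp
      ((measurable_snd.prodMk hWm).prodMk measurable_const))
    (fun p => (Metric.continuous_infDist_pt F).comp (by fun_prop))
    (fun _ _ => Metric.infDist_nonneg)
    (fun p => by
      obtain ⟨z, hz⟩ := hex p
      exact ⟨z, ⟨hz.1, hz.2.1.1⟩, (hFcl.mem_iff_infDist_zero hFne).1 hz⟩)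
  have hsF' : ∀ p : (ℝ × ℝ) × unitInterval, ((p.2, W p.1 p.2), s p) ∈ F := fun p =>
    (hFcl.mem_iff_infDist_zero hFne).2 (hsF p).2
  refine ⟨fun p => (s p).1, fun p => (s p).2, hs.fst, hs.snd, fun p => (hsF' p).1,
    fun p => (hsF' p).2.1, fun y hy => ?_⟩
  -- This also rewrites the `y` inside `s`; the second rewriting by `hWv` undoes that.
  rw [← hWv y hy]
  congr 1
  ext1 x
  rw [hWv y hy]
  exact (hsF' (y, x)).2.2.symm

end Structure

/-! ### Implementation of the recursively defined payoffs by promise keeping -/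

section Sufficiency

variable {μ : Measure unitInterval} {n t m : ℕ}
  {i j : Fin 2} {V Q : ℕ → (ℝ × ℝ) × unitInterval → ℝ × ℝ} {y : ℝ × ℝ}

/-- The payoff vector promised to the players after a history without takers: `y` at the beginning,
then updated by `V`. -/
def promise (V : ℕ → (ℝ × ℝ) × unitInterval → ℝ × ℝ) (n : ℕ) (y : ℝ × ℝ) :
    (t : ℕ) → History t → ℝ × ℝ
  | 0, _ => y
  -- After `t + 1` stages `n - (t + 1)` samples are still to arrive.
  | t + 1, h => V (n - (t + 1))
      (promise V n y t (Fin.init (α := fun _ => StageRecord) h), (h (Fin.last t)).sample)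

theorem promise_addStage (h : History t) (r : StageRecord) :
    promise V n y (t + 1) (addStage h r) = V (n - (t + 1)) (promise V n y t h, r.sample) := by
  rw [promise, init_addStage, addStage_last]

theorem measurable_promise (hV : ∀ m, Measurable (V m)) (t : ℕ) :
    Measurable (promise V n y t) := by
  induction t with
  | zero => exact measurable_const
  | succ t ih =>
    have h1 : Measurable fun h : History (t + 1) => Fin.init (α := fun _ => StageRecord) h :=
      measurable_pi_iff.2 fun s => measurable_pi_apply s.castSucc
    exact (hV _).comp ((ih.comp h1).prodMk (measurable_sample.comp (measurable_pi_apply _)))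

theorem measurable_coord (i : Fin 2) : Measurable fun z : ℝ × ℝ => coord z i := by
  unfold coord
  split_ifs
  exacts [measurable_fst, measurable_snd]

open Classical in
/-- Bid according to `Q`, as a function of the promised payoffs, while the other player is present,
and according to the optimal stopping rule when alone. -/
def promiseStrategy (μ : Measure unitInterval) (hV : ∀ m, Measurable (V m))
    (hQ : ∀ m, Measurable (Q m)) (n : ℕ) (y : ℝ × ℝ) (i : Fin 2) : Strategy where
  bid t h x := if Present h (1 - i) then
      -- The values of `Q` are not known here to be probabilities, hence the clipping; for stage
      -- equilibria it changes nothing.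
      Set.projIcc 0 1 zero_le_one (coord (Q (n - (t + 1)) (promise V n y t h, x)) i)
    else if soloValue μ (n - (t + 1)) ≤ x then 1 else 0
  measurable_bid t := by
    refine Measurable.ite (measurable_fst (measurableSet_present (1 - i))) ?_
      (Measurable.ite (measurableSet_le measurable_const
        (measurable_subtype_coe.comp measurable_snd)) measurable_const measurable_const)
    exact continuous_projIcc.measurable.comp ((measurable_coord i).comp ((hQ _).comp
      (((measurable_promise hV t).comp measurable_fst).prodMk measurable_snd)))

theorem eq_one_sub_of_ne (hij : i ≠ j) : j = 1 - i := by
  rcases ne_iff_fin_two.1 hij with ⟨rfl, rfl⟩ | ⟨rfl, rfl⟩ <;> rfl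

theorem coord_mem_Icc {q : ℝ × ℝ} (hq : q ∈ Set.Icc (0 : ℝ × ℝ) 1) (i : Fin 2) :
    coord q i ∈ Set.Icc (0 : ℝ) 1 := by
  unfold coord
  split_ifs
  exacts [⟨hq.1.1, hq.2.1⟩, ⟨hq.1.2, hq.2.2⟩]

variable [IsProbabilityMeasure μ]

/-- Promises are kept: while both are present, continuation payoffs equal the promised vector, by
backward induction with `hval`. Bids are then stage equilibria for the true continuation values, so
no one-shot deviation pays. Since `V` takes values in `eqValues` everywhere, this also holds after
histories off the path of play. -/
theorem isSPE_promiseStrategy (hV : ∀ m, Measurable (V m)) (hQ : ∀ m, Measurable (Q m))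
    (hVm : ∀ m p, V m p ∈ eqValues μ m)
    (hVQ : ∀ m p, IsStageEq p.2 (soloValue μ m) (V m p) (Q m p))
    (hval : ∀ m, ∀ y ∈ eqValues μ (m + 1),
      vint μ (fun x => stageValue x (soloValue μ m) (V m (y, x)) (Q m (y, x))) = y)
    (n : ℕ) {y : ℝ × ℝ} (hy : y ∈ eqValues μ n) :
    IsSPE μ n (promiseStrategy μ hV hQ n y) ∧ ∀ i, payoff μ n (promiseStrategy μ hV hQ n y) i =
      coord y i := by
  set σ : Profile := promiseStrategy μ hV hQ n y with hσ
  have hbid_solo : ∀ {t m : ℕ}, t + 1 + m = n → ∀ {i j : Fin 2}, i ≠ j → ∀ (h : History t),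
      Present h i → ¬ Present h j → ∀ x : unitInterval,
      bidding σ h x i = if soloValue μ m ≤ x then 1 else 0 := by
    intro t m hn i j hij h hi hj x
    have hm : n - (t + 1) = m := by omega
    rw [bidding_of_present hi]
    simp only [hσ, promiseStrategy, ← eq_one_sub_of_ne hij, hj, hm, if_false]
    split_ifs <;> simp
  have hbid_both : ∀ {t m : ℕ}, t + 1 + m = n → ∀ {i j : Fin 2}, i ≠ j → ∀ (h : History t),
      Present h i → Present h j → ∀ x : unitInterval,
      bidding σ h x i = coord (Q m (promise V n y t h, x)) i := by
    intro t m hn i j hij h hi hj x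
    have hm : n - (t + 1) = m := by omega
    rw [bidding_of_present hi]
    simp only [hσ, promiseStrategy, ← eq_one_sub_of_ne hij, hj, hm, if_true]
    rw [Set.projIcc_of_mem zero_le_one (coord_mem_Icc (hVQ _ _).1 i)]
  have hsolo : ∀ m t, t + m = n → ∀ {i j : Fin 2}, i ≠ j → ∀ h : History t,
      Present h i → ¬ Present h j → contPayoff μ σ i m h = soloValue μ m := by
    intro m
    induction m with
    | zero => exact fun t _ i j _ h hi _ => receipts_of_present hi
    | succ m ih =>
      intro t hn i j hij h hi hj
      refine integral_congr_ae (Filter.Eventually.of_forall fun x => ?_)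
      change stageExpectation σ h x (fun r => contPayoff μ σ i m (addStage h r)) =
        max (x : ℝ) (soloValue μ m)
      rw [stageExpectation_solo hij hi hj, hbid_solo (m := m) (by omega) hij h hi hj,
        ih (t + 1) (by omega) hij _ ((present_passRecord x).2 hi) (mt (present_passRecord x).1 hj)]
      split_ifs with hx
      · rw [max_eq_left hx]; ring
      · rw [max_eq_right (not_le.1 hx).le]; ring
  have hstage : ∀ {t m : ℕ}, t + 1 + m = n → ∀ {i j : Fin 2}, i ≠ j → ∀ (h : History t),
      Present h i → Present h j → ∀ (x : unitInterval) (σ' : Profile),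
      stageExpectation σ' h x (fun r => contPayoff μ σ i m (addStage h r)) =
        stagePayoff x (soloValue μ m) (contPayoff μ σ i m (addStage h (passRecord x)))
          (bidding σ' h x i) (bidding σ' h x j) := fun hn i j hij h hi hj x σ' =>
    stageExpectation_both hij hi x
      (hsolo _ _ hn hij _ ((present_bothRecord x).2 ⟨hi, hij⟩)
        fun h => ((present_bothRecord x).1 h).2 rfl)
      (hsolo _ _ hn hij _ ((present_singleRecord x).2 ⟨hi, hij⟩)
        fun h => ((present_singleRecord x).1 h).2 rfl)
  -- Membership of the promise in `eqValues` is what makes `hval` applicable; it holds at the root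
  -- by `hy` and after each joint pass by `hVm`.
  have hboth : ∀ m t, t + m = n → ∀ h : History t, (∀ k, Present h k) →
      promise V n y t h ∈ eqValues μ m → ∀ i, contPayoff μ σ i m h = coord (promise V n y t h) i := by
    intro m
    induction m with
    | zero =>
      intro t _ h hp hP i
      rw [show promise V n y t h = 0 from hP, contPayoff, receipts_of_present (hp i)]
      simp [coord]
    | succ m ih =>
      intro t hn h hp hP i
      have hn' : t + 1 + m = n := by omega
      have hm : n - (t + 1) = m := by omega
      obtain ⟨j, hij⟩ : ∃ j, i ≠ j := ⟨1 - i, by fin_cases i <;> decide⟩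
      have hx : ∀ x, contPayoffAt μ σ i m h x = coord (stageValue x (soloValue μ m)
          (V m (promise V n y t h, x)) (Q m (promise V n y t h, x))) i := by
        intro x
        have hpr : promise V n y (t + 1) (addStage h (passRecord x)) =
            V m (promise V n y t h, x) := by
          rw [promise_addStage, hm]
          rfl
        rw [contPayoffAt, hstage hn' hij h (hp i) (hp j),
          ih (t + 1) hn' _ (fun k => (present_passRecord x).2 (hp k)) (hpr ▸ hVm _ _), hpr,
          hbid_both hn' hij h (hp i) (hp j), hbid_both hn' hij.symm h (hp j) (hp i),
          coord_stageValue hij]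
      rw [contPayoff_succ]
      simp only [hx]
      have hv := hval m _ hP
      fin_cases i
      · exact congrArg Prod.fst hv
      · exact congrArg Prod.snd hv
  refine ⟨isSPE_of_oneShot fun t m hn h x i τ => ?_, fun i => ?_⟩
  · obtain ⟨j, hij⟩ : ∃ j, i ≠ j := ⟨1 - i, by fin_cases i <;> decide⟩
    by_cases hi : Present h i
    swap
    · rw [contPayoffAt, stageExpectation_of_not_present hij hi,
        stageExpectation_of_not_present hij hi, bidding_update_of_ne hij.symm]
    have hq := bidding_mem_Icc (Function.update σ i τ) h x i
    by_cases hj : Present h j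
    · have hp : ∀ k, Present h k := fun k => by
        by_cases hk : k = i
        · exact hk ▸ hi
        · rwa [eq_one_sub_of_ne (Ne.symm hk), ← eq_one_sub_of_ne hij]
      have hm : n - (t + 1) = m := by omega
      have hpr : promise V n y (t + 1) (addStage h (passRecord x)) =
          V m (promise V n y t h, x) := by
        rw [promise_addStage, hm]
        rfl
      rw [contPayoffAt, hstage hn hij h hi hj, hstage hn hij h hi hj,
        hboth m (t + 1) hn _ (fun k => (present_passRecord x).2 (hp k)) (hpr ▸ hVm _ _), hpr,
        bidding_update_of_ne hij.symm, hbid_both hn hij h hi hj, hbid_both hn hij.symm h hj hi]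
      exact (hVQ m (promise V n y t h, x)).coord_le hij hq
    · rw [contPayoffAt, stageExpectation_solo hij hi hj, stageExpectation_solo hij hi hj,
        hbid_solo hn hij h hi hj, hsolo m (t + 1) hn hij _ ((present_passRecord x).2 hi)
          (mt (present_passRecord x).1 hj)]
      split_ifs with hx
      · nlinarith [mul_nonneg (sub_nonneg.2 hq.2) (sub_nonneg.2 hx)]
      · nlinarith [mul_nonneg hq.1 (sub_nonneg.2 (not_le.1 hx).le)]
  · exact hboth n 0 (zero_add n) _ (fun k s => s.elim0) hy i

/-- For an atomless law the equilibrium payoffs are given by the backward recursion. -/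
theorem spePayoffs_eq_eqValues (μ : Measure unitInterval) [IsProbabilityMeasure μ]
    [NullSingletonClass μ] (n : ℕ) : spePayoffs μ n = eqValues μ n := by
  ext y
  constructor
  · rintro ⟨σ, hσ, rfl⟩
    exact hσ.mem_eqValues n 0 (zero_add n) _ (fun s => s.elim0) fun k s => s.elim0
  · intro hy
    choose V Q hV hQ hVm hVQ hval using exists_implementation μ
    obtain ⟨h1, h2⟩ := isSPE_promiseStrategy hV hQ hVm hVQ hval n hy
    exact ⟨_, h1, Prod.ext (h2 0).symm (h2 1).symm⟩

end Sufficiency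

/-! ### Exchanging the players -/

section Swap

variable {μ : Measure unitInterval} {σ : Profile} {i : Fin 2} {n t m : ℕ}

/-- The record with the roles of the players exchanged. -/
def swapRecord (r : StageRecord) : StageRecord :=
  (r.sample, fun k => r.bids (1 - k), r.taker.map fun k => 1 - k)

/-- The history with the roles of the players exchanged. -/
def swapHistory (h : History t) : History t := fun s => swapRecord (h s)

theorem one_sub_one_sub (i : Fin 2) : 1 - (1 - i) = i := by
  fin_cases i <;> rfl

theorem swapRecord_swapRecord (r : StageRecord) : swapRecord (swapRecord r) = r := by
  obtain ⟨x, b, w⟩ := r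
  simp [swapRecord, StageRecord.sample, StageRecord.bids, StageRecord.taker]

theorem swapHistory_swapHistory (h : History t) : swapHistory (swapHistory h) = h :=
  funext fun s => swapRecord_swapRecord (h s)

theorem taker_swapRecord (r : StageRecord) (i : Fin 2) :
    (swapRecord r).taker = some i ↔ r.taker = some (1 - i) := by
  obtain ⟨x, b, w⟩ := r
  simp only [swapRecord, StageRecord.taker, Option.map_eq_some_iff]
  constructor
  · rintro ⟨k, rfl, rfl⟩
    rw [one_sub_one_sub]
  · rintro rfl
    exact ⟨_, rfl, one_sub_one_sub i⟩

theorem measurable_swapHistory : Measurable (swapHistory : History t → History t) := by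
  have hr : Measurable swapRecord := by
    refine measurable_sample.prodMk (Measurable.prodMk ?_ ?_)
    · exact measurable_pi_iff.2 fun k =>
        (measurable_pi_apply (1 - k)).comp (measurable_fst.comp measurable_snd)
    · have hmap : Measurable (Option.map fun k : Fin 2 => 1 - k) := measurable_from_top
      exact hmap.comp measurable_taker
  exact measurable_pi_iff.2 fun s => hr.comp (measurable_pi_apply s)

/-- The strategy with the roles of the players exchanged. -/
def Strategy.swap (τ : Strategy) : Strategy where
  bid t h x := τ.bid t (swapHistory h) x
  measurable_bid t := (τ.measurable_bid t).comp
    ((measurable_swapHistory.comp measurable_fst).prodMk measurable_snd)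

theorem Strategy.swap_swap (τ : Strategy) : τ.swap.swap = τ := by
  simp only [Strategy.swap, swapHistory_swapHistory]

/-- The profile with the roles of the players exchanged. -/
def swapProfile (σ : Profile) : Profile := fun i => (σ (1 - i)).swap

/-- Deviations of one player from the exchanged profile are the exchanged deviations of the other
player, so the equilibrium inequalities correspond. -/
theorem update_swapProfile (σ : Profile) (i : Fin 2) (τ : Strategy) :
    Function.update (swapProfile σ) i τ = swapProfile (Function.update σ (1 - i) τ.swap) := by
  funext k
  by_cases hk : k = i
  · subst hk
    simp [swapProfile, Strategy.swap_swap]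
  · have : 1 - k ≠ 1 - i := fun h => hk (by rw [← one_sub_one_sub k, h, one_sub_one_sub])
    simp [swapProfile, hk, this]

theorem present_swapHistory (h : History t) (i : Fin 2) :
    Present (swapHistory h) i ↔ Present h (1 - i) :=
  forall_congr' fun s => not_congr (taker_swapRecord (h s) i)

theorem swapHistory_addStage (h : History t) (r : StageRecord) :
    swapHistory (addStage h r) = addStage (swapHistory h) (swapRecord r) := by
  funext s
  induction s using Fin.lastCases with
  | last => simp [swapHistory]
  | cast s => simp [swapHistory]

theorem feasible_swapHistory {h : History t} (hh : Feasible h) : Feasible (swapHistory h) := by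
  intro s
  obtain ⟨f1, f2, f3⟩ := hh s
  refine ⟨fun i hi r hr => ?_, fun i hi => ?_, fun hn i => ?_⟩
  · exact mt (taker_swapRecord (h r) i).1 (f1 (1 - i) hi r hr)
  · exact f2 (1 - i) ((taker_swapRecord (h s) i).1 hi)
  · exact f3 (Option.map_eq_none_iff.1 hn) (1 - i)

theorem receipts_swapHistory (h : History t) (i : Fin 2) :
    receipts (swapHistory h) i = receipts h (1 - i) := by
  refine Finset.sum_congr rfl fun s _ => ?_
  simp only [swapHistory, taker_swapRecord]
  rfl

theorem bidding_swapProfile (σ : Profile) (h : History t) (x : unitInterval) (i : Fin 2) :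
    bidding (swapProfile σ) h x i = bidding σ (swapHistory h) x (1 - i) := by
  have hp : Present (swapHistory h) (1 - i) ↔ Present h i := by
    rw [present_swapHistory, one_sub_one_sub]
  by_cases hi : Present h i
  · rw [bidding_of_present hi, bidding_of_present (hp.2 hi)]
    rfl
  · rw [bidding_of_not_present hi, bidding_of_not_present (mt hp.1 hi)]

theorem stageExpectation_swapProfile (σ : Profile) (h : History t) (x : unitInterval)
    (g : StageRecord → ℝ) : stageExpectation (swapProfile σ) h x (fun r => g (swapRecord r)) =
      stageExpectation σ (swapHistory h) x g := by
  have hb : ∀ i, swapRecord (bothRecord x i) = bothRecord x (1 - i) := fun i => rfl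
  have hs : ∀ i, swapRecord (singleRecord x i) = singleRecord x (1 - i) := fun i => by
    refine Prod.ext rfl (Prod.ext (funext fun k => ?_) rfl)
    change decide (1 - k = i) = decide (k = 1 - i)
    revert i k
    decide
  have hp : swapRecord (passRecord x) = passRecord x := rfl
  -- The expansion is used in opposite orders of the players on the two sides, so that the terms
  -- match.
  rw [stageExpectation_eq _ h x _ (zero_ne_one (α := Fin 2)),
    stageExpectation_eq σ (swapHistory h) x g (one_ne_zero (α := Fin 2))]
  simp only [bidding_swapProfile, hb, hs, hp, sub_zero, sub_self]

theorem contPayoff_swapProfile (σ : Profile) (i : Fin 2) (m : ℕ) : ∀ {t : ℕ} (h : History t),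
    contPayoff μ (swapProfile σ) i m h = contPayoff μ σ (1 - i) m (swapHistory h) := by
  induction m with
  | zero =>
    intro t h
    rw [contPayoff, contPayoff, receipts_swapHistory, one_sub_one_sub]
  | succ m ih =>
    intro t h
    refine integral_congr_ae (Filter.Eventually.of_forall fun x => ?_)
    simp only [ih, swapHistory_addStage]
    exact stageExpectation_swapProfile σ h x
      fun r => contPayoff μ σ (1 - i) m (addStage (swapHistory h) r)

theorem contPayoffAt_swapProfile (σ : Profile) (i : Fin 2) (m : ℕ) (h : History t)
    (x : unitInterval) : contPayoffAt μ (swapProfile σ) i m h x =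
      contPayoffAt μ σ (1 - i) m (swapHistory h) x := by
  simp only [contPayoffAt, contPayoff_swapProfile, swapHistory_addStage]
  exact stageExpectation_swapProfile σ h x
    fun r => contPayoff μ σ (1 - i) m (addStage (swapHistory h) r)

theorem IsSPE.swap (hσ : IsSPE μ n σ) : IsSPE μ n (swapProfile σ) := by
  refine ⟨fun t m hn h hh i τ => ?_, fun t m hn h hh x i τ => ?_⟩
  · rw [update_swapProfile, contPayoff_swapProfile, contPayoff_swapProfile]
    exact hσ.1 t m hn _ (feasible_swapHistory hh) _ _
  · rw [update_swapProfile, contPayoffAt_swapProfile, contPayoffAt_swapProfile]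
    exact hσ.2 t m hn _ (feasible_swapHistory hh) _ _ _

theorem payoff_swapProfile (μ : Measure unitInterval) (n : ℕ) (σ : Profile) (i : Fin 2) :
    payoff μ n (swapProfile σ) i = payoff μ n σ (1 - i) := by
  unfold payoff
  rw [contPayoff_swapProfile]
  congr 1
  exact Subsingleton.elim _ _

theorem swap_mem_spePayoffs {u v : ℝ} (h : (u, v) ∈ spePayoffs μ n) : (v, u) ∈ spePayoffs μ n := by
  obtain ⟨σ, hσ, he⟩ := h
  obtain ⟨rfl, rfl⟩ := Prod.mk.inj he
  exact ⟨swapProfile σ, hσ.swap, by rw [payoff_swapProfile, payoff_swapProfile]; rfl⟩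

end Swap

/-- A law on the unit interval with a continuous distribution function has no atoms. -/
theorem nullSingletonClass_of_continuous (μ : Measure unitInterval) [IsProbabilityMeasure μ]
    (h : Continuous (distributionFunction μ)) : NullSingletonClass μ := by
  have : IsProbabilityMeasure (μ.map ((↑) : unitInterval → ℝ)) :=
    Measure.isProbabilityMeasure_map measurable_subtype_coe.aemeasurable
  refine ⟨fun x => ?_⟩
  -- The mass of a point is the jump of the distribution function there.
  have h1 : μ.map ((↑) : unitInterval → ℝ) {(x : ℝ)} = 0 := by
    rw [← ProbabilityTheory.measure_cdf (μ.map ((↑) : unitInterval → ℝ)),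
      StieltjesFunction.measure_singleton, ENNReal.ofReal_eq_zero]
    have hc : ContinuousAt (ProbabilityTheory.cdf (μ.map ((↑) : unitInterval → ℝ))) (x : ℝ) :=
      h.continuousAt
    rw [hc.continuousWithinAt.leftLim_eq]
    simp
  rw [Measure.map_apply measurable_subtype_coe (measurableSet_singleton _)] at h1
  refine measure_mono_null ?_ h1
  rintro z rfl
  rfl

end NoRecallGame

end

theorem mainTheorem4 (μ : MeasureTheory.Measure unitInterval)
    [MeasureTheory.IsProbabilityMeasure μ] (n : ℕ) :
    (∀ u v : ℝ, (u, v) ∈ NoRecallGame.spePayoffs μ n → (v, u) ∈ NoRecallGame.spePayoffs μ n) ∧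
    (Continuous (NoRecallGame.distributionFunction μ) →
      Convex ℝ (NoRecallGame.spePayoffs μ n) ∧ IsCompact (NoRecallGame.spePayoffs μ n)) := by
  refine ⟨fun u v => NoRecallGame.swap_mem_spePayoffs, fun hF => ?_⟩
  have := NoRecallGame.nullSingletonClass_of_continuous μ hF
  rw [NoRecallGame.spePayoffs_eq_eqValues]
  exact ⟨(NoRecallGame.eqValues_spec μ n).2.1, (NoRecallGame.eqValues_spec μ n).1⟩
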